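/- Let $0<\omega<\tfrac{\alpha}{2}$, and let $(a,b)$ be the solution of $a^2+b^2=1$, $ab=\omega/\alpha$, $0<a<b$. Consider on $\mathbb{R}$ the system \[ u''=F(u,v):=-u(1-u^2-v^2)-v(\omega-\alpha uv),\qquad v''=G(u,v):=-v(1-u^2-v^2)-u(\omega-\alpha uv), \] subject to \[ (u(x),v(x))\to(a,b)\ \text{ as } x\to-\infty,\qquad (u(x),v(x))\to(b,a)\ \text{ as } x\to+\infty . \] Then this problem has a positive solution, i.e. a solution $(u,v)$ of class $C^2$ with $u>0$ and $v>0$ on $\mathbb{R}$. Any two positive solutions are translates of each other: if $(u,v)$ and $(\bar u,\bar v)$ are positive solutions, then there is a constant $T\in\mathbb{R}$ such that $\bar u(x)=u(x+T)$ and $\bar v(x)=v(x+T)$ for all $x\in\mathbb{R}$. Furthermore, every positive solution satisfies $u'>0$ and $v'<0$ on $\mathbb{R}$. -/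

import Mathlib

open Filter Topology

/-- Right-hand side of the first equation: `-u(1-u²-v²) - v(ω-αuv)`. -/
def rhsF (α ω u v : ℝ) : ℝ :=
  -u * (1 - u ^ 2 - v ^ 2) - v * (ω - α * u * v)

/-- Right-hand side of the second equation: `-v(1-u²-v²) - u(ω-αuv)`. -/
def rhsG (α ω u v : ℝ) : ℝ :=
  -v * (1 - u ^ 2 - v ^ 2) - u * (ω - α * u * v)

/-- `(u, v)` is a positive classical (`C²`) solution on the whole line of
`u'' = F(u,v)`, `v'' = G(u,v)` with `(u,v) → (a,b)` at `-∞` and `(u,v) → (b,a)` at `+∞`. -/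
structure IsPositiveHeteroclinic (α ω a b : ℝ) (u v : ℝ → ℝ) : Prop where
  contDiff_u : ContDiff ℝ 2 u
  contDiff_v : ContDiff ℝ 2 v
  eq_u : ∀ x, deriv (deriv u) x = rhsF α ω (u x) (v x)
  eq_v : ∀ x, deriv (deriv v) x = rhsG α ω (u x) (v x)
  pos_u : ∀ x, 0 < u x
  pos_v : ∀ x, 0 < v x
  tendsto_u_atBot : Tendsto u atBot (𝓝 a)
  tendsto_v_atBot : Tendsto v atBot (𝓝 b)
  tendsto_u_atTop : Tendsto u atTop (𝓝 b)
  tendsto_v_atTop : Tendsto v atTop (𝓝 a)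

/-! ### Calculus on the line -/

/-! In the rotated unknowns s = u + v, d = v - u, with A = 1/2 + α/4, B = 1/2 - α/4, the system
reads s'' = s (A s² + B d² - 1 - ω), d'' = d (A d² + B s² - 1 + ω). Evaluating it at extrema of uv,
s, d², u and v confines every positive solution to the box [a, b]² and to the region (2 + α) uv > ω.
There F increases in v and G increases in u, so the system is competitive and admits comparison for
the order "u' ≤ u and v ≤ v'" between two solutions.

Uniqueness and monotonicity come from sliding. Two ordered solutions that touch coincide
(`IsBoxSolution.eq_of_touch`), and near the wells the order propagates along half lines
(`IsWellPair.exists_comparison_left` and its mirror image). Hence, of two positive solutions, a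
large translate of one dominates the other; at the least such translation they must touch, hence
agree (`exists_eq_translate`). Sliding a solution against itself gives u' ≥ 0 ≥ v', and strictness
follows from ODE uniqueness.

For existence a front symmetric under x ↦ -x with u and v exchanged is sought: d odd, s even. Let
(c, 0) be the saddle in the (s, d) plane and S, D the values of s, d at the well (a, b). Normalising
d to τ = ±d/D and interpolating s = c + (S - c) σ turns the system, for τ ≥ 0 and whatever the sign
of B, into a cooperative one. Inverting z'' = κ² (z - H) by its Green kernel gives an order
preserving iteration, which decreases from (sign, 1). A tanh profile, exact for s = c, stays below
it on [0, ∞) and rules out the limit τ = 0; the wells are then the only possible end states. -/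

theorem deriv_deriv_nonneg_of_isLocalMin {f : ℝ → ℝ} {x : ℝ} (h : IsLocalMin f x)
    (hc : ContinuousAt f x) : 0 ≤ deriv (deriv f) x := by
  by_contra! hneg
  -- A negative second derivative at a critical point makes the minimum also a local maximum, so f
  -- is locally constant and its second derivative vanishes.
  have hmax := isLocalMax_of_deriv_deriv_neg hneg h.deriv_eq_zero hc
  have heq : f =ᶠ[𝓝 x] fun _ => f x := by
    filter_upwards [h, hmax] with y hy1 hy2 using le_antisymm hy2 hy1
  have h2 := heq.deriv.deriv_eq
  simp at h2
  linarith

theorem deriv_deriv_nonpos_of_isLocalMax {f : ℝ → ℝ} {x : ℝ} (h : IsLocalMax f x)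
    (hc : ContinuousAt f x) : deriv (deriv f) x ≤ 0 := by
  have := deriv_deriv_nonneg_of_isLocalMin (f := fun y => -f y) h.neg hc.neg
  simp at this
  exact this

theorem ContDiff.hasDerivAt_two {f : ℝ → ℝ} (hf : ContDiff ℝ 2 f) (x : ℝ) :
    HasDerivAt f (deriv f x) x ∧ HasDerivAt (deriv f) (deriv (deriv f) x) x := by
  have h1 : ContDiff ℝ 1 (deriv f) := by
    have : ContDiff ℝ (1 + 1) f := by simpa [one_add_one_eq_two] using hf
    exact (contDiff_succ_iff_deriv.1 this).2.2
  exact ⟨(hf.differentiable (by norm_num) x).hasDerivAt,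
    (h1.differentiable (by norm_num) x).hasDerivAt⟩

/-- A value strictly below both limits confines the minimisation to a compact set. Together with the
mirror statement for maxima this is what makes pointwise maximum principles available on the whole
line. -/
theorem exists_forall_le_of_tendsto {f : ℝ → ℝ} (hf : Continuous f) {l m x₀ : ℝ}
    (hbot : Tendsto f atBot (𝓝 l)) (htop : Tendsto f atTop (𝓝 m)) (hl : f x₀ < l)
    (hm : f x₀ < m) : ∃ x, f x ≤ f x₀ ∧ ∀ y, f x ≤ f y := by
  have h : ∀ᶠ x in cocompact ℝ, f x₀ ≤ f x := by
    rw [cocompact_eq_atBot_atTop, eventually_sup]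
    exact ⟨(hbot.eventually (lt_mem_nhds hl)).mono fun _ h => le_of_lt h,
      (htop.eventually (lt_mem_nhds hm)).mono fun _ h => le_of_lt h⟩
  obtain ⟨x, hx⟩ := hf.exists_forall_le' x₀ h
  exact ⟨x, hx x₀, hx⟩

theorem exists_forall_ge_of_tendsto {f : ℝ → ℝ} (hf : Continuous f) {l m x₀ : ℝ}
    (hbot : Tendsto f atBot (𝓝 l)) (htop : Tendsto f atTop (𝓝 m)) (hl : l < f x₀)
    (hm : m < f x₀) : ∃ x, f x₀ ≤ f x ∧ ∀ y, f y ≤ f x := by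
  obtain ⟨x, h1, h2⟩ := exists_forall_le_of_tendsto hf.neg hbot.neg htop.neg
    (neg_lt_neg hl) (neg_lt_neg hm)
  exact ⟨x, neg_le_neg_iff.1 h1, fun y => neg_le_neg_iff.1 (h2 y)⟩

/-- Uniqueness for a pair of second order differential inequalities. -/
theorem eq_zero_of_abs_deriv_deriv_le {z w : ℝ → ℝ} {K x₀ : ℝ} (hz : ContDiff ℝ 2 z)
    (hw : ContDiff ℝ 2 w) (hK : 0 ≤ K)
    (hz2 : ∀ x, |deriv (deriv z) x| ≤ K * (|z x| + |w x|))
    (hw2 : ∀ x, |deriv (deriv w) x| ≤ K * (|z x| + |w x|))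
    (z0 : z x₀ = 0) (w0 : w x₀ = 0) (z1 : deriv z x₀ = 0) (w1 : deriv w x₀ = 0) (x : ℝ) :
    z x = 0 ∧ w x = 0 := by
  -- Grönwall argument: |e'| ≤ (1 + 2K) e, so e vanishes forwards and backwards from a zero.
  set e : ℝ → ℝ := fun x => z x ^ 2 + deriv z x ^ 2 + w x ^ 2 + deriv w x ^ 2 with he
  set e' : ℝ → ℝ := fun x => 2 * z x * deriv z x + 2 * deriv z x * deriv (deriv z) x
    + 2 * w x * deriv w x + 2 * deriv w x * deriv (deriv w) x with he'
  have hd : ∀ x, HasDerivAt e (e' x) x := by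
    intro x
    obtain ⟨a1, a2⟩ := hz.hasDerivAt_two x
    obtain ⟨b1, b2⟩ := hw.hasDerivAt_two x
    refine ((((a1.pow 2).add (a2.pow 2)).add (b1.pow 2)).add (b2.pow 2)).congr_deriv ?_
    simp only [he']
    push_cast
    ring
  have hb : ∀ x, |e' x| ≤ (1 + 2 * K) * e x := by
    intro x
    have key : ∀ p q : ℝ, |2 * p * q| ≤ p ^ 2 + q ^ 2 := fun p q => by
      rw [abs_le]; constructor <;> nlinarith [sq_nonneg (p + q), sq_nonneg (p - q)]
    have key2 : ∀ p q : ℝ, |q| ≤ K * (|z x| + |w x|) →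
        |2 * p * q| ≤ K * (2 * p ^ 2 + z x ^ 2 + w x ^ 2) := fun p q hq => by
      rw [abs_mul, abs_mul, abs_two]
      have h1 : 2 * |p| * |q| ≤ 2 * |p| * (K * (|z x| + |w x|)) := by gcongr
      have h2 : 2 * |p| * (|z x| + |w x|) ≤ 2 * p ^ 2 + z x ^ 2 + w x ^ 2 := by
        rw [← sq_abs p, ← sq_abs (z x), ← sq_abs (w x)]
        nlinarith [sq_nonneg (|p| - |z x|), sq_nonneg (|p| - |w x|)]
      nlinarith [mul_le_mul_of_nonneg_left h2 hK]
    have t1 := key (z x) (deriv z x)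
    have t2 := key (w x) (deriv w x)
    have t3 := key2 (deriv z x) _ (hz2 x)
    have t4 := key2 (deriv w x) _ (hw2 x)
    have h1 := abs_add_le (2 * z x * deriv z x + 2 * deriv z x * deriv (deriv z) x
      + 2 * w x * deriv w x) (2 * deriv w x * deriv (deriv w) x)
    have h2 := abs_add_le (2 * z x * deriv z x + 2 * deriv z x * deriv (deriv z) x)
      (2 * w x * deriv w x)
    have h3 := abs_add_le (2 * z x * deriv z x) (2 * deriv z x * deriv (deriv z) x)
    simp only [he, he']
    linarith
  have e0 : e x₀ = 0 := by simp [he, z0, w0, z1, w1]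
  have hex : e x ≤ 0 := by
    rcases le_total x₀ x with hx | hx
    · have hanti : Antitone fun x => e x * Real.exp (-(1 + 2 * K) * x) := by
        apply antitone_of_hasDerivAt_nonpos
          (f' := fun x => e' x * Real.exp (-(1 + 2 * K) * x)
            + e x * (Real.exp (-(1 + 2 * K) * x) * (-(1 + 2 * K))))
        · intro y
          refine (hd y).mul ?_
          simpa using ((hasDerivAt_id y).const_mul (-(1 + 2 * K))).exp
        · intro y
          have := (abs_le.1 (hb y)).2
          have h0 := Real.exp_pos (-(1 + 2 * K) * y)
          simp only [Pi.zero_apply]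
          nlinarith
      have := hanti hx
      simp only [e0, zero_mul] at this
      exact nonpos_of_mul_nonpos_left this (Real.exp_pos _)
    · have hmono : Monotone fun x => e x * Real.exp ((1 + 2 * K) * x) := by
        apply monotone_of_hasDerivAt_nonneg
          (f' := fun x => e' x * Real.exp ((1 + 2 * K) * x)
            + e x * (Real.exp ((1 + 2 * K) * x) * (1 + 2 * K)))
        · intro y
          refine (hd y).mul ?_
          simpa using ((hasDerivAt_id y).const_mul (1 + 2 * K)).exp
        · intro y
          have := (abs_le.1 (hb y)).1
          have h0 := Real.exp_pos ((1 + 2 * K) * y)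
          simp only [Pi.zero_apply]
          nlinarith
      have := hmono hx
      simp only [e0, zero_mul] at this
      exact nonpos_of_mul_nonpos_left this (Real.exp_pos _)
  simp only [he] at hex
  constructor
  · nlinarith [sq_nonneg (z x), sq_nonneg (w x), sq_nonneg (deriv z x), sq_nonneg (deriv w x)]
  · nlinarith [sq_nonneg (z x), sq_nonneg (w x), sq_nonneg (deriv z x), sq_nonneg (deriv w x)]

/-! ### A priori bounds -/

/-- The standing assumptions on the parameters and the wells `(a, b)`, `(b, a)`. -/
structure IsWellPair (α ω a b : ℝ) : Prop where
  omega_pos : 0 < ω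
  omega_lt : ω < α / 2
  sq_add_sq : a ^ 2 + b ^ 2 = 1
  mul_eq : α * (a * b) = ω
  pos : 0 < a
  lt : a < b

theorem IsWellPair.alpha_pos {α ω a b : ℝ} (hw : IsWellPair α ω a b) : 0 < α := by
  linarith [hw.omega_pos, hw.omega_lt]

theorem rhsG_eq_rhsF (α ω u v : ℝ) : rhsG α ω u v = rhsF α ω v u := by
  simp only [rhsF, rhsG]; ring

theorem deriv_deriv_comp_neg (f : ℝ → ℝ) (x : ℝ) :
    deriv (deriv fun y => f (-y)) x = deriv (deriv f) (-x) := by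
  have h1 : (deriv fun y => f (-y)) = fun y => -deriv f (-y) :=
    funext fun y => deriv_comp_neg f y
  rw [h1, deriv.fun_neg, deriv_comp_neg (deriv f), neg_neg]

theorem deriv_deriv_add {f g : ℝ → ℝ} (hf : ContDiff ℝ 2 f) (hg : ContDiff ℝ 2 g) (x : ℝ) :
    deriv (deriv fun y => f y + g y) x = deriv (deriv f) x + deriv (deriv g) x := by
  have h1 : (deriv fun y => f y + g y) = fun y => deriv f y + deriv g y :=
    funext fun y => ((hf.hasDerivAt_two y).1.add (hg.hasDerivAt_two y).1).deriv
  rw [h1]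
  exact ((hf.hasDerivAt_two x).2.add (hg.hasDerivAt_two x).2).deriv

theorem deriv_deriv_sub {f g : ℝ → ℝ} (hf : ContDiff ℝ 2 f) (hg : ContDiff ℝ 2 g) (x : ℝ) :
    deriv (deriv fun y => f y - g y) x = deriv (deriv f) x - deriv (deriv g) x := by
  have h1 : (deriv fun y => f y - g y) = fun y => deriv f y - deriv g y :=
    funext fun y => ((hf.hasDerivAt_two y).1.sub (hg.hasDerivAt_two y).1).deriv
  rw [h1]
  exact ((hf.hasDerivAt_two x).2.sub (hg.hasDerivAt_two x).2).deriv

theorem deriv_mul_eq {f g : ℝ → ℝ} (hf : ContDiff ℝ 2 f) (hg : ContDiff ℝ 2 g) :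
    (deriv fun y => f y * g y) = fun y => deriv f y * g y + f y * deriv g y :=
  funext fun y => ((hf.hasDerivAt_two y).1.mul (hg.hasDerivAt_two y).1).deriv

theorem deriv_deriv_mul {f g : ℝ → ℝ} (hf : ContDiff ℝ 2 f) (hg : ContDiff ℝ 2 g) (x : ℝ) :
    deriv (deriv fun y => f y * g y) x =
      deriv (deriv f) x * g x + 2 * (deriv f x * deriv g x) + f x * deriv (deriv g) x := by
  obtain ⟨f1, f2⟩ := hf.hasDerivAt_two x
  obtain ⟨g1, g2⟩ := hg.hasDerivAt_two x
  rw [deriv_mul_eq hf hg]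
  refine ((f2.mul g1).add (f1.mul g2)).deriv.trans ?_
  ring

namespace IsPositiveHeteroclinic

variable {α ω a b : ℝ} {u v : ℝ → ℝ}

theorem reflect (h : IsPositiveHeteroclinic α ω a b u v) :
    IsPositiveHeteroclinic α ω a b (fun x => v (-x)) (fun x => u (-x)) where
  contDiff_u := h.contDiff_v.comp contDiff_neg
  contDiff_v := h.contDiff_u.comp contDiff_neg
  eq_u x := by rw [deriv_deriv_comp_neg, h.eq_v, rhsG_eq_rhsF]
  eq_v x := by rw [deriv_deriv_comp_neg, h.eq_u, rhsG_eq_rhsF]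
  pos_u x := h.pos_v _
  pos_v x := h.pos_u _
  tendsto_u_atBot := h.tendsto_v_atTop.comp tendsto_neg_atBot_atTop
  tendsto_v_atBot := h.tendsto_u_atTop.comp tendsto_neg_atBot_atTop
  tendsto_u_atTop := h.tendsto_v_atBot.comp tendsto_neg_atTop_atBot
  tendsto_v_atTop := h.tendsto_u_atBot.comp tendsto_neg_atTop_atBot

/-- At a minimum of uv, the relation u'v + uv' = 0 forces u'v' ≤ 0. The remaining part of (uv)'' is
(u² + v²)((2 + α) uv - ω) - 2uv (1), strictly negative if (2 + α) uv ≤ ω. At the wells uv = ω/α is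
larger, so a low value would produce such a minimum. -/
theorem lt_mul (h : IsPositiveHeteroclinic α ω a b u v) (hw : IsWellPair α ω a b) (x : ℝ) :
    ω < (2 + α) * (u x * v x) := by
  have hα := hw.alpha_pos
  have hω := hw.omega_pos
  by_contra! hx
  have hlt : u x * v x < a * b := by
    have h1 : 0 < a * b := mul_pos hw.pos (hw.pos.trans hw.lt)
    have := hw.mul_eq
    nlinarith
  obtain ⟨y, hy, hmin⟩ := exists_forall_le_of_tendsto (f := fun x => u x * v x)
    (h.contDiff_u.continuous.mul h.contDiff_v.continuous)
    (h.tendsto_u_atBot.mul h.tendsto_v_atBot) (h.tendsto_u_atTop.mul h.tendsto_v_atTop)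
    hlt (by rw [mul_comm b a]; exact hlt)
  have hloc : IsLocalMin (fun x => u x * v x) y := Eventually.of_forall hmin
  have h2 := deriv_deriv_nonneg_of_isLocalMin hloc
    (h.contDiff_u.continuous.mul h.contDiff_v.continuous).continuousAt
  have h1 := hloc.deriv_eq_zero
  rw [deriv_mul_eq h.contDiff_u h.contDiff_v] at h1
  rw [deriv_deriv_mul h.contDiff_u h.contDiff_v, h.eq_u, h.eq_v] at h2
  simp only [rhsF, rhsG] at h1 h2 hy
  have hu := h.pos_u y
  have hv := h.pos_v y
  have hp : 0 < u y * v y := mul_pos hu hv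
  set u' := deriv u y
  set v' := deriv v y
  have h3 : u' * v' ≤ 0 := by
    have : (u' * v') * (u y * v y) ≤ 0 := by
      have e1 : u' * v y = -(u y * v') := by linarith
      calc (u' * v') * (u y * v y) = (u' * v y) * (u y * v') := by ring
        _ = -(u y * v') ^ 2 := by rw [e1]; ring
        _ ≤ 0 := neg_nonpos.2 (sq_nonneg _)
    exact nonpos_of_mul_nonpos_left this hp
  have h4 : (u y ^ 2 + v y ^ 2) * ((2 + α) * (u y * v y) - ω) ≤ 0 := by
    apply mul_nonpos_of_nonneg_of_nonpos (by positivity)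
    nlinarith
  nlinarith

/-- The sign of s'' at the extremum, divided by s > 0, with 1 + ω rewritten as A (a + b)² + B (b -
a)². The next two lemmas are the analogues for minima of s and maxima of d². -/
theorem sum_at_max (h : IsPositiveHeteroclinic α ω a b u v) (hw : IsWellPair α ω a b) {x : ℝ}
    (hx : ∀ y, u y + v y ≤ u x + v x) :
    (1 / 2 + α / 4) * ((u x + v x) ^ 2 - (a + b) ^ 2) ≤
      (1 / 2 - α / 4) * ((b - a) ^ 2 - (v x - u x) ^ 2) := by
  have h2 := deriv_deriv_nonpos_of_isLocalMax (f := fun x => u x + v x) (x := x)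
    (Eventually.of_forall hx)
    (h.contDiff_u.continuous.add h.contDiff_v.continuous).continuousAt
  rw [deriv_deriv_add h.contDiff_u h.contDiff_v, h.eq_u, h.eq_v] at h2
  have e1 : rhsF α ω (u x) (v x) + rhsG α ω (u x) (v x) = (u x + v x) *
      ((1 / 2 + α / 4) * (u x + v x) ^ 2 + (1 / 2 - α / 4) * (v x - u x) ^ 2 - 1 - ω) := by
    simp only [rhsF, rhsG]; ring
  rw [e1] at h2
  have h3 := nonpos_of_mul_nonpos_right h2 (add_pos (h.pos_u x) (h.pos_v x))
  have := hw.mul_eq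
  have := hw.sq_add_sq
  nlinarith

theorem sum_at_min (h : IsPositiveHeteroclinic α ω a b u v) (hw : IsWellPair α ω a b) {x : ℝ}
    (hx : ∀ y, u x + v x ≤ u y + v y) :
    (1 / 2 - α / 4) * ((b - a) ^ 2 - (v x - u x) ^ 2) ≤
      (1 / 2 + α / 4) * ((u x + v x) ^ 2 - (a + b) ^ 2) := by
  have h2 := deriv_deriv_nonneg_of_isLocalMin (f := fun x => u x + v x) (x := x)
    (Eventually.of_forall hx)
    (h.contDiff_u.continuous.add h.contDiff_v.continuous).continuousAt
  rw [deriv_deriv_add h.contDiff_u h.contDiff_v, h.eq_u, h.eq_v] at h2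
  have e1 : rhsF α ω (u x) (v x) + rhsG α ω (u x) (v x) = (u x + v x) *
      ((1 / 2 + α / 4) * (u x + v x) ^ 2 + (1 / 2 - α / 4) * (v x - u x) ^ 2 - 1 - ω) := by
    simp only [rhsF, rhsG]; ring
  rw [e1] at h2
  have h3 := nonneg_of_mul_nonneg_right h2 (add_pos (h.pos_u x) (h.pos_v x))
  have := hw.mul_eq
  have := hw.sq_add_sq
  nlinarith

theorem diff_at_max (h : IsPositiveHeteroclinic α ω a b u v) (hw : IsWellPair α ω a b) {x : ℝ}
    (hx : ∀ y, (v y - u y) ^ 2 ≤ (v x - u x) ^ 2) (h0 : v x - u x ≠ 0) :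
    (1 / 2 + α / 4) * ((v x - u x) ^ 2 - (b - a) ^ 2) ≤
      (1 / 2 - α / 4) * ((a + b) ^ 2 - (u x + v x) ^ 2) := by
  have hc : ContinuousAt (fun x => v x - u x) x :=
    (h.contDiff_v.continuous.sub h.contDiff_u.continuous).continuousAt
  have e1 : rhsG α ω (u x) (v x) - rhsF α ω (u x) (v x) = (v x - u x) *
      ((1 / 2 + α / 4) * (v x - u x) ^ 2 + (1 / 2 - α / 4) * (u x + v x) ^ 2 - 1 + ω) := by
    simp only [rhsF, rhsG]; ring
  have key : (1 / 2 + α / 4) * (v x - u x) ^ 2 + (1 / 2 - α / 4) * (u x + v x) ^ 2 - 1 + ω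
      ≤ 0 := by
    rcases lt_or_gt_of_ne h0 with hneg | hpos
    · have h2 := deriv_deriv_nonneg_of_isLocalMin (f := fun x => v x - u x) (x := x)
        (Eventually.of_forall fun y => by
          have := sq_le_sq.1 (hx y)
          rw [abs_of_neg hneg] at this
          change v x - u x ≤ v y - u y
          linarith [neg_abs_le (v y - u y)]) hc
      rw [deriv_deriv_sub h.contDiff_v h.contDiff_u, h.eq_u, h.eq_v, e1] at h2
      by_contra! hk
      nlinarith
    · have h2 := deriv_deriv_nonpos_of_isLocalMax (f := fun x => v x - u x) (x := x)
        (Eventually.of_forall fun y => by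
          have := sq_le_sq.1 (hx y)
          rw [abs_of_pos hpos] at this
          change v y - u y ≤ v x - u x
          linarith [le_abs_self (v y - u y)]) hc
      rw [deriv_deriv_sub h.contDiff_v h.contDiff_u, h.eq_u, h.eq_v, e1] at h2
      exact nonpos_of_mul_nonpos_right h2 hpos
  have := hw.mul_eq
  have := hw.sq_add_sq
  nlinarith

theorem tendsto_sum (h : IsPositiveHeteroclinic α ω a b u v) :
    Tendsto (fun x => u x + v x) atBot (𝓝 (a + b)) ∧
      Tendsto (fun x => u x + v x) atTop (𝓝 (a + b)) :=
  ⟨h.tendsto_u_atBot.add h.tendsto_v_atBot, by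
    rw [add_comm a b]; exact h.tendsto_u_atTop.add h.tendsto_v_atTop⟩

theorem continuous_sum (h : IsPositiveHeteroclinic α ω a b u v) :
    Continuous fun x => u x + v x := h.contDiff_u.continuous.add h.contDiff_v.continuous

/-- If d² exceeds its value at the wells, its maximum pushes s² to one side of (a + b)², by at least
A/|B| times the excess of d². The extremum of s on that side pushes d² back by the same factor. As A
> |B| the two inequalities are incompatible; the side is decided by the sign of B, that is, of 2 -
α. -/
theorem sq_diff_le (h : IsPositiveHeteroclinic α ω a b u v) (hw : IsWellPair α ω a b) (x : ℝ) :
    (v x - u x) ^ 2 ≤ (b - a) ^ 2 := by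
  by_contra! hx
  have hα := hw.alpha_pos
  have hS : 0 < a + b := by linarith [hw.pos, hw.lt]
  obtain ⟨y, hy, hmax⟩ := exists_forall_ge_of_tendsto (f := fun x => (v x - u x) ^ 2)
    ((h.contDiff_v.continuous.sub h.contDiff_u.continuous).pow 2)
    ((h.tendsto_v_atBot.sub h.tendsto_u_atBot).pow 2)
    ((h.tendsto_v_atTop.sub h.tendsto_u_atTop).pow 2) hx
    (by rw [show (a - b) ^ 2 = (b - a) ^ 2 by ring]; exact hx)
  have hX : (b - a) ^ 2 < (v y - u y) ^ 2 := hx.trans_le hy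
  have h1 := h.diff_at_max hw hmax (fun h0 => by
    rw [h0] at hX; nlinarith [sq_nonneg (b - a)])
  obtain ⟨hbot, htop⟩ := h.tendsto_sum
  have hsy := add_pos (h.pos_u y) (h.pos_v y)
  rcases le_total 2 α with hB | hB
  · have hlt : a + b < u y + v y := by
      by_contra! hle
      nlinarith [mul_nonneg (sub_nonneg.2 hle) (by linarith : 0 ≤ a + b + (u y + v y))]
    obtain ⟨w, hwy, hwmax⟩ := exists_forall_ge_of_tendsto h.continuous_sum hbot htop hlt hlt
    have h2 := h.sum_at_max hw hwmax
    have h3 : (v w - u w) ^ 2 ≤ (v y - u y) ^ 2 := hmax w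
    have h4 : (u y + v y) ^ 2 ≤ (u w + v w) ^ 2 := by gcongr
    nlinarith [mul_nonneg (by linarith : 0 ≤ α - 2) (sub_nonneg.2 h3),
      mul_nonneg (by linarith : 0 ≤ α - 2) (sub_nonneg.2 h4)]
  · have hlt : u y + v y < a + b := by
      by_contra! hle
      nlinarith [mul_nonneg (sub_nonneg.2 hle) (by linarith : 0 ≤ a + b + (u y + v y))]
    obtain ⟨w, hwy, hwmin⟩ := exists_forall_le_of_tendsto h.continuous_sum hbot htop hlt hlt
    have h2 := h.sum_at_min hw hwmin
    have h3 : (v w - u w) ^ 2 ≤ (v y - u y) ^ 2 := hmax w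
    have h4 : (u w + v w) ^ 2 ≤ (u y + v y) ^ 2 := by
      have := add_pos (h.pos_u w) (h.pos_v w)
      gcongr
    nlinarith [mul_nonneg (by linarith : 0 ≤ 2 - α) (sub_nonneg.2 h3),
      mul_nonneg (by linarith : 0 ≤ 2 - α) (sub_nonneg.2 h4)]

theorem sum_le (h : IsPositiveHeteroclinic α ω a b u v) (hw : IsWellPair α ω a b)
    (hα2 : 2 ≤ α) (x : ℝ) : u x + v x ≤ a + b := by
  by_contra! hlt
  obtain ⟨hbot, htop⟩ := h.tendsto_sum
  obtain ⟨y, hy, hmax⟩ := exists_forall_ge_of_tendsto h.continuous_sum hbot htop hlt hlt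
  have h2 := h.sum_at_max hw hmax
  have h3 := h.sq_diff_le hw y
  have : a + b < u y + v y := hlt.trans_le hy
  have hS : 0 < a + b := by linarith [hw.pos, hw.lt]
  have h4 : (a + b) ^ 2 < (u y + v y) ^ 2 := by gcongr
  nlinarith [mul_nonneg (by linarith : 0 ≤ α - 2) (sub_nonneg.2 h3),
    mul_pos (by linarith : 0 < 1 / 2 + α / 4) (sub_pos.2 h4)]

theorem le_sum (h : IsPositiveHeteroclinic α ω a b u v) (hw : IsWellPair α ω a b)
    (hα2 : α ≤ 2) (x : ℝ) : a + b ≤ u x + v x := by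
  by_contra! hlt
  obtain ⟨hbot, htop⟩ := h.tendsto_sum
  obtain ⟨y, hy, hmin⟩ := exists_forall_le_of_tendsto h.continuous_sum hbot htop hlt hlt
  have h2 := h.sum_at_min hw hmin
  have h3 := h.sq_diff_le hw y
  have h4 : u y + v y < a + b := hy.trans_lt hlt
  have := add_pos (h.pos_u y) (h.pos_v y)
  have hα := hw.alpha_pos
  have h5 : (u y + v y) ^ 2 < (a + b) ^ 2 := by gcongr
  nlinarith [mul_nonneg (by linarith : 0 ≤ 2 - α) (sub_nonneg.2 h3),
    mul_pos (by linarith : 0 < 1 / 2 + α / 4) (sub_pos.2 h5)]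

theorem abs_diff_le (h : IsPositiveHeteroclinic α ω a b u v) (hw : IsWellPair α ω a b) (x : ℝ) :
    |v x - u x| ≤ b - a :=
  abs_le_of_sq_le_sq (h.sq_diff_le hw x) (by linarith [hw.lt])

/-- One bound follows by combining the bounds on s and d. For the other, at an extremum of u or v
beyond its bound, |v - u| ≤ b - a pushes the other component the same way, so 1 - u² - v² and ω -
αuv share a sign that contradicts the extremum. -/
theorem bounds_at_left (h : IsPositiveHeteroclinic α ω a b u v) (hw : IsWellPair α ω a b)
    (x : ℝ) : a ≤ u x ∧ v x ≤ b := by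
  have hα := hw.alpha_pos
  have ha := hw.pos
  have hab := hw.lt
  have hmul := hw.mul_eq
  have hsq := hw.sq_add_sq
  rcases le_total 2 α with hB | hB
  · refine ⟨?_, by linarith [h.sum_le hw hB x, (abs_le.1 (h.abs_diff_le hw x)).2]⟩
    by_contra! hlt
    obtain ⟨y, hy, hmin⟩ := exists_forall_le_of_tendsto h.contDiff_u.continuous
      h.tendsto_u_atBot h.tendsto_u_atTop hlt (hlt.trans hw.lt)
    have h2 := deriv_deriv_nonneg_of_isLocalMin (Eventually.of_forall hmin : IsLocalMin u y)
      h.contDiff_u.continuous.continuousAt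
    rw [h.eq_u, rhsF] at h2
    have hu := h.pos_u y
    have hv := h.pos_v y
    have hua : u y < a := hy.trans_lt hlt
    have hvb : v y < b := by linarith [(abs_le.1 (h.abs_diff_le hw y)).2]
    have h3 : u y * v y < a * b := by nlinarith
    have h4 : u y ^ 2 + v y ^ 2 < 1 := by nlinarith
    have h5 : 0 < ω - α * u y * v y := by nlinarith
    nlinarith [mul_pos hu (sub_pos.2 h4), mul_pos hv h5]
  · refine ⟨by linarith [h.le_sum hw hB x, (abs_le.1 (h.abs_diff_le hw x)).2], ?_⟩
    by_contra! hlt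
    obtain ⟨y, hy, hmax⟩ := exists_forall_ge_of_tendsto h.contDiff_v.continuous
      h.tendsto_v_atBot h.tendsto_v_atTop hlt (hw.lt.trans hlt)
    have h2 := deriv_deriv_nonpos_of_isLocalMax (Eventually.of_forall hmax : IsLocalMax v y)
      h.contDiff_v.continuous.continuousAt
    rw [h.eq_v, rhsG] at h2
    have hu := h.pos_u y
    have hv := h.pos_v y
    have hvb : b < v y := hlt.trans_le hy
    have hua : a < u y := by linarith [(abs_le.1 (h.abs_diff_le hw y)).2]
    have h3 : a * b < u y * v y := by nlinarith
    have h4 : 1 < u y ^ 2 + v y ^ 2 := by nlinarith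
    have h5 : 0 < α * u y * v y - ω := by nlinarith
    nlinarith [mul_pos hv (sub_pos.2 h4), mul_pos hu h5]

end IsPositiveHeteroclinic

/-- Solutions on the line with values in the box `[a, b]²`, in the region where the system is
competitive. -/
structure IsBoxSolution (α ω a b : ℝ) (u v : ℝ → ℝ) : Prop where
  contDiff_u : ContDiff ℝ 2 u
  contDiff_v : ContDiff ℝ 2 v
  eq_u : ∀ x, deriv (deriv u) x = rhsF α ω (u x) (v x)
  eq_v : ∀ x, deriv (deriv v) x = rhsF α ω (v x) (u x)
  mem_u : ∀ x, u x ∈ Set.Icc a b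
  mem_v : ∀ x, v x ∈ Set.Icc a b
  lt_mul : ∀ x, ω < (2 + α) * (u x * v x)

theorem IsPositiveHeteroclinic.isBoxSolution {α ω a b : ℝ} {u v : ℝ → ℝ}
    (h : IsPositiveHeteroclinic α ω a b u v) (hw : IsWellPair α ω a b) :
    IsBoxSolution α ω a b u v where
  contDiff_u := h.contDiff_u
  contDiff_v := h.contDiff_v
  eq_u := h.eq_u
  eq_v x := by rw [h.eq_v, rhsG_eq_rhsF]
  mem_u x := ⟨(h.bounds_at_left hw x).1, by simpa using (h.reflect.bounds_at_left hw (-x)).2⟩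
  mem_v x := ⟨by simpa using (h.reflect.bounds_at_left hw (-x)).1, (h.bounds_at_left hw x).2⟩
  lt_mul := h.lt_mul hw

/-! ### Comparison of solutions -/

/-- Competitiveness. Only the smaller product u v₁ has to lie in the region, since the divided
difference in v increases with v₂. -/
theorem rhsF_lt_rhsF {α ω u v₁ v₂ : ℝ} (hα : 0 ≤ α) (hu : 0 < u) (hv : 0 ≤ v₁) (h : v₁ < v₂)
    (hp : ω < (2 + α) * (u * v₁)) : rhsF α ω u v₁ < rhsF α ω u v₂ := by
  have e : rhsF α ω u v₂ - rhsF α ω u v₁ = (v₂ - v₁) * ((1 + α) * u * (v₁ + v₂) - ω) := by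
    simp only [rhsF]; ring
  have h1 : (2 + α) * (u * v₁) ≤ (1 + α) * u * (v₁ + v₂) := by
    nlinarith [mul_pos hu (sub_pos.2 h), mul_nonneg hα (mul_pos hu (sub_pos.2 h)).le,
      mul_nonneg hα (mul_nonneg hu.le hv)]
  have := mul_pos (sub_pos.2 h) (by linarith : 0 < (1 + α) * u * (v₁ + v₂) - ω)
  linarith

theorem rhsF_le_rhsF {α ω u v₁ v₂ : ℝ} (hα : 0 ≤ α) (hu : 0 < u) (hv : 0 ≤ v₁) (h : v₁ ≤ v₂)
    (hp : ω < (2 + α) * (u * v₁)) : rhsF α ω u v₁ ≤ rhsF α ω u v₂ := by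
  rcases h.eq_or_lt with rfl | h
  · rfl
  · exact (rhsF_lt_rhsF hα hu hv h hp).le

theorem exists_abs_rhsF_sub_le (α ω a b : ℝ) : ∃ K : ℝ, 0 ≤ K ∧ ∀ u ∈ Set.Icc a b,
    ∀ v ∈ Set.Icc a b, ∀ u' ∈ Set.Icc a b, ∀ v' ∈ Set.Icc a b,
      |rhsF α ω u v - rhsF α ω u' v'| ≤ K * (|u - u'| + |v - v'|) := by
  have h1 : ContDiff ℝ 1 fun p : ℝ × ℝ => rhsF α ω p.1 p.2 := by
    unfold rhsF; fun_prop
  obtain ⟨K, hK⟩ := (h1.locallyLipschitz.locallyLipschitzOn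
    (s := Set.Icc a b ×ˢ Set.Icc a b)).exists_lipschitzOnWith_of_compact
      (isCompact_Icc.prod isCompact_Icc)
  refine ⟨K, K.2, fun u hu v hv u' hu' v' hv' => ?_⟩
  have := hK.dist_le_mul (u, v) ⟨hu, hv⟩ (u', v') ⟨hu', hv'⟩
  rw [Real.dist_eq, Prod.dist_eq, Real.dist_eq, Real.dist_eq] at this
  refine this.trans ?_
  gcongr
  exact max_le_add_of_nonneg (abs_nonneg _) (abs_nonneg _)

namespace IsBoxSolution

variable {α ω a b : ℝ} {u v u' v' : ℝ → ℝ}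

theorem swap (h : IsBoxSolution α ω a b u v) : IsBoxSolution α ω a b v u where
  contDiff_u := h.contDiff_v
  contDiff_v := h.contDiff_u
  eq_u := h.eq_v
  eq_v := h.eq_u
  mem_u := h.mem_v
  mem_v := h.mem_u
  lt_mul x := by rw [mul_comm (v x)]; exact h.lt_mul x

theorem comp_neg (h : IsBoxSolution α ω a b u v) :
    IsBoxSolution α ω a b (fun x => u (-x)) (fun x => v (-x)) where
  contDiff_u := h.contDiff_u.comp contDiff_neg
  contDiff_v := h.contDiff_v.comp contDiff_neg
  eq_u x := by rw [deriv_deriv_comp_neg, h.eq_u]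
  eq_v x := by rw [deriv_deriv_comp_neg, h.eq_v]
  mem_u x := h.mem_u _
  mem_v x := h.mem_v _
  lt_mul x := h.lt_mul _

theorem comp_add_const (h : IsBoxSolution α ω a b u v) (T : ℝ) :
    IsBoxSolution α ω a b (fun x => u (x + T)) (fun x => v (x + T)) where
  contDiff_u := h.contDiff_u.comp (contDiff_id.add contDiff_const)
  contDiff_v := h.contDiff_v.comp (contDiff_id.add contDiff_const)
  eq_u x := by
    have : (deriv fun x => u (x + T)) = fun x => deriv u (x + T) :=
      funext fun x => deriv_comp_add_const u T x
    rw [this, deriv_comp_add_const, h.eq_u]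
  eq_v x := by
    have : (deriv fun x => v (x + T)) = fun x => deriv v (x + T) :=
      funext fun x => deriv_comp_add_const v T x
    rw [this, deriv_comp_add_const, h.eq_v]
  mem_u x := h.mem_u _
  mem_v x := h.mem_v _
  lt_mul x := h.lt_mul _

theorem const (hw : IsWellPair α ω a b) : IsBoxSolution α ω a b (fun _ => b) (fun _ => a) where
  contDiff_u := contDiff_const
  contDiff_v := contDiff_const
  eq_u x := by
    simp only [rhsF, deriv_const', deriv_const]
    linear_combination (-b) * hw.sq_add_sq - a * hw.mul_eq
  eq_v x := by
    simp only [rhsF, deriv_const', deriv_const]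
    linear_combination (-a) * hw.sq_add_sq - b * hw.mul_eq
  mem_u x := ⟨hw.lt.le, le_rfl⟩
  mem_v x := ⟨le_rfl, hw.lt.le⟩
  lt_mul x := by
    have := hw.mul_eq
    have := mul_pos hw.pos (hw.pos.trans hw.lt)
    linarith

theorem eq_of_initial (h : IsBoxSolution α ω a b u v) (h' : IsBoxSolution α ω a b u' v')
    {x₀ : ℝ} (hu : u' x₀ = u x₀) (hv : v' x₀ = v x₀) (hu1 : deriv u' x₀ = deriv u x₀)
    (hv1 : deriv v' x₀ = deriv v x₀) (x : ℝ) : u' x = u x ∧ v' x = v x := by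
  obtain ⟨K, hK0, hK⟩ := exists_abs_rhsF_sub_le α ω a b
  have key := eq_zero_of_abs_deriv_deriv_le (z := fun x => u' x - u x) (w := fun x => v' x - v x)
    (x₀ := x₀) (h'.contDiff_u.sub h.contDiff_u) (h'.contDiff_v.sub h.contDiff_v) hK0
    (fun x => by
      rw [deriv_deriv_sub h'.contDiff_u h.contDiff_u, h.eq_u, h'.eq_u]
      exact hK _ (h'.mem_u x) _ (h'.mem_v x) _ (h.mem_u x) _ (h.mem_v x))
    (fun x => by
      rw [deriv_deriv_sub h'.contDiff_v h.contDiff_v, h.eq_v, h'.eq_v, add_comm |u' x - u x|]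
      exact hK _ (h'.mem_v x) _ (h'.mem_u x) _ (h.mem_v x) _ (h.mem_u x))
    (by simp [hu]) (by simp [hv])
    (by
      exact ((h'.contDiff_u.hasDerivAt_two x₀).1.sub
        (h.contDiff_u.hasDerivAt_two x₀).1).deriv.trans (by rw [hu1, sub_self]))
    (by
      exact ((h'.contDiff_v.hasDerivAt_two x₀).1.sub
        (h.contDiff_v.hasDerivAt_two x₀).1).deriv.trans (by rw [hv1, sub_self])) x
  exact ⟨sub_eq_zero.1 key.1, sub_eq_zero.1 key.2⟩

theorem deriv_eq_of_touch {f g : ℝ → ℝ} (hf : ContDiff ℝ 2 f) (hg : ContDiff ℝ 2 g)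
    (hle : ∀ x, f x ≤ g x) {x₀ : ℝ} (h : f x₀ = g x₀) :
    deriv f x₀ = deriv g x₀ ∧ deriv (deriv f) x₀ ≤ deriv (deriv g) x₀ := by
  have hmin : IsLocalMin (fun x => g x - f x) x₀ := Eventually.of_forall fun x => by
    simp only [h, sub_self]; exact sub_nonneg.2 (hle x)
  have h1 := hmin.deriv_eq_zero
  have h2 := deriv_deriv_nonneg_of_isLocalMin hmin (hg.continuous.sub hf.continuous).continuousAt
  rw [deriv_deriv_sub hg hf] at h2
  have h3 := ((hg.hasDerivAt_two x₀).1.sub (hf.hasDerivAt_two x₀).1).deriv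
  have h4 : deriv (fun x => g x - f x) x₀ = deriv g x₀ - deriv f x₀ := h3
  rw [h1] at h4
  exact ⟨by linarith, by linarith⟩

/-- Where u' and u touch, the second derivatives are ordered; strict monotonicity of F in v then
forces v and v' to touch as well. Both contacts are tangential, so all Cauchy data agree and ODE
uniqueness replaces a strong maximum principle. -/
theorem eq_of_touch_left (hw : IsWellPair α ω a b) (h : IsBoxSolution α ω a b u v)
    (h' : IsBoxSolution α ω a b u' v') (hle : ∀ x, u' x ≤ u x ∧ v x ≤ v' x) {x₀ : ℝ}
    (h0 : u' x₀ = u x₀) (x : ℝ) : u' x = u x ∧ v' x = v x := by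
  obtain ⟨hu1, hu2⟩ := deriv_eq_of_touch h'.contDiff_u h.contDiff_u (fun x => (hle x).1) h0
  rw [h.eq_u, h'.eq_u, h0] at hu2
  have hv0 : v x₀ = v' x₀ := by
    refine le_antisymm (hle x₀).2 ?_
    by_contra! hlt
    exact absurd (rhsF_lt_rhsF hw.alpha_pos.le (hw.pos.trans_le (h.mem_u x₀).1)
      (hw.pos.trans_le (h.mem_v x₀).1).le hlt (h.lt_mul x₀)) (not_lt.2 hu2)
  have hv1 := (deriv_eq_of_touch h.contDiff_v h'.contDiff_v (fun x => (hle x).2) hv0).1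
  exact h.eq_of_initial h' h0 hv0.symm hu1 hv1.symm x

theorem eq_of_touch (hw : IsWellPair α ω a b) (h : IsBoxSolution α ω a b u v)
    (h' : IsBoxSolution α ω a b u' v') (hle : ∀ x, u' x ≤ u x ∧ v x ≤ v' x) {x₀ : ℝ}
    (h0 : u' x₀ = u x₀ ∨ v' x₀ = v x₀) (x : ℝ) : u' x = u x ∧ v' x = v x := by
  rcases h0 with h0 | h0
  · exact eq_of_touch_left hw h h' hle h0 x
  · have := eq_of_touch_left hw h'.swap h.swap (fun x => ⟨(hle x).2, (hle x).1⟩) h0.symm x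
    exact ⟨this.2.symm, this.1.symm⟩

end IsBoxSolution

/-- Near the well `(a, b)` the nonlinearity is monotone along a suitable competitive direction. -/
theorem IsWellPair.exists_descent {α ω a b : ℝ} (hw : IsWellPair α ω a b) :
    ∃ φ ψ ε : ℝ, 0 < φ ∧ 0 < ψ ∧ 0 < ε ∧ ∀ p q m : ℝ, |p - a| < ε → |q - b| < ε → 0 < m →
      m < ε → rhsF α ω (p - m * φ) (q + m * ψ) < rhsF α ω p q ∧
        rhsF α ω q p < rhsF α ω (q + m * ψ) (p - m * φ) ∧
        ω < (2 + α) * ((p - m * φ) * (q + m * ψ)) ∧ 0 < p - m * φ ∧ 0 < q + m * ψ := by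
  have hα := hw.alpha_pos
  have ha := hw.pos
  have hb : 0 < b := ha.trans hw.lt
  have hk : 0 < (α + 2) * (a * b) := by positivity
  -- The Jacobian of (F, G) at (a, b) has diagonal entries f, g and off-diagonal entry k. The
  -- direction (φ, ψ) = (g + k, f + k) is chosen so that fφ - kψ and gψ - kφ both equal the
  -- determinant.
  set k := (α + 2) * (a * b) with hkdef
  set f := 2 * a ^ 2 + α * b ^ 2 with hf
  set g := 2 * b ^ 2 + α * a ^ 2 with hg
  have hdet : 0 < f * g - k ^ 2 := by
    have : f * g - k ^ 2 = 2 * α * ((b - a) * (b + a)) ^ 2 := by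
      simp only [hkdef, hf, hg]; ring
    rw [this]
    have := sub_pos.2 hw.lt
    positivity
  have hφ : 0 < g + k := by positivity
  have hψ : 0 < f + k := by positivity
  set φ := g + k with hφdef
  set ψ := f + k with hψdef
  have h1 : 0 < f * φ - k * ψ := by rw [hφdef, hψdef]; linarith
  have h2 : 0 < g * ψ - k * φ := by rw [hφdef, hψdef]; linarith
  -- Exact divided differences in m of the two nonlinearities along (-φ, ψ). Their signs at (a, b,
  -- 0) persist nearby by continuity.
  let Q₁ : ℝ × ℝ × ℝ → ℝ := fun x =>
    φ - φ * ((x.1 - x.2.2 * φ) ^ 2 + (x.1 - x.2.2 * φ) * x.1 + x.1 ^ 2) +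
      (1 + α) * ((x.1 - x.2.2 * φ) * ψ * (x.2.1 + x.2.2 * ψ + x.2.1) - φ * x.2.1 ^ 2) - ω * ψ
  let Q₂ : ℝ × ℝ × ℝ → ℝ := fun x =>
    -ψ + ψ * ((x.2.1 + x.2.2 * ψ) ^ 2 + (x.2.1 + x.2.2 * ψ) * x.2.1 + x.2.1 ^ 2) +
      (1 + α) * (-(x.2.1 + x.2.2 * ψ) * φ * (x.1 - x.2.2 * φ + x.1) + ψ * x.1 ^ 2) + ω * φ
  have c1 : Continuous Q₁ := by fun_prop
  have c2 : Continuous Q₂ := by fun_prop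
  have n1 : Q₁ (a, b, 0) < 0 := by
    have : Q₁ (a, b, 0) = -(f * φ - k * ψ) := by
      simp only [Q₁, hkdef, hf]
      linear_combination (-φ) * hw.sq_add_sq + ψ * hw.mul_eq
    linarith
  have n2 : 0 < Q₂ (a, b, 0) := by
    have : Q₂ (a, b, 0) = g * ψ - k * φ := by
      simp only [Q₂, hkdef, hg]
      linear_combination ψ * hw.sq_add_sq - φ * hw.mul_eq
    linarith
  have e1 : ∀ᶠ x in 𝓝 (a, b, (0 : ℝ)), Q₁ x < 0 := c1.continuousAt.eventually (gt_mem_nhds n1)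
  have e2 : ∀ᶠ x in 𝓝 (a, b, (0 : ℝ)), 0 < Q₂ x := c2.continuousAt.eventually (lt_mem_nhds n2)
  have e3 : ∀ᶠ x : ℝ × ℝ × ℝ in 𝓝 (a, b, (0 : ℝ)),
      ω < (2 + α) * ((x.1 - x.2.2 * φ) * (x.2.1 + x.2.2 * ψ)) := by
    refine (by fun_prop : Continuous fun x : ℝ × ℝ × ℝ =>
      (2 + α) * ((x.1 - x.2.2 * φ) * (x.2.1 + x.2.2 * ψ))).continuousAt.eventually
        (lt_mem_nhds ?_)
    have := hw.mul_eq
    have : 0 < a * b := by positivity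
    simp only [zero_mul, sub_zero, add_zero]
    linarith
  have e4 : ∀ᶠ x : ℝ × ℝ × ℝ in 𝓝 (a, b, (0 : ℝ)), 0 < x.1 - x.2.2 * φ :=
    (by fun_prop : Continuous fun x : ℝ × ℝ × ℝ => x.1 - x.2.2 * φ).continuousAt.eventually
        (lt_mem_nhds (by simpa using ha))
  have e5 : ∀ᶠ x : ℝ × ℝ × ℝ in 𝓝 (a, b, (0 : ℝ)), 0 < x.2.1 + x.2.2 * ψ :=
    (by fun_prop : Continuous fun x : ℝ × ℝ × ℝ => x.2.1 + x.2.2 * ψ).continuousAt.eventually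
        (lt_mem_nhds (by simpa using hb))
  obtain ⟨ε, hε, hball⟩ := Metric.eventually_nhds_iff.1 (e1.and (e2.and (e3.and (e4.and e5))))
  refine ⟨φ, ψ, ε, hφ, hψ, hε, fun p q m hp hq hm hmε => ?_⟩
  obtain ⟨r1, r2, r3, r4, r5⟩ := hball (y := (p, q, m)) (by
    rw [Prod.dist_eq, Prod.dist_eq, Real.dist_eq, Real.dist_eq, Real.dist_eq, sub_zero,
      abs_of_pos hm]
    exact max_lt hp (max_lt hq hmε))
  refine ⟨?_, ?_, r3, r4, r5⟩
  · have : rhsF α ω (p - m * φ) (q + m * ψ) - rhsF α ω p q = m * Q₁ (p, q, m) := by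
      simp only [rhsF, Q₁]; ring
    exact sub_neg.1 (this ▸ mul_neg_of_pos_of_neg hm r1)
  · have : rhsF α ω (q + m * ψ) (p - m * φ) - rhsF α ω q p = m * Q₂ (p, q, m) := by
      simp only [rhsF, Q₂]; ring
    exact sub_pos.1 (this ▸ mul_pos hm r2)

/-- Comparison on a half line `(-∞, x₁]` on which the lower solution is close to `(a, b)`. -/
theorem IsWellPair.exists_comparison_left {α ω a b : ℝ} (hw : IsWellPair α ω a b) :
    ∃ ε > 0, ∀ u v u' v' : ℝ → ℝ, IsBoxSolution α ω a b u v → IsBoxSolution α ω a b u' v' →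
      Tendsto (fun x => u x - u' x) atBot (𝓝 0) → Tendsto (fun x => v' x - v x) atBot (𝓝 0) →
      ∀ x₁, (∀ x ≤ x₁, |u' x - a| < ε ∧ |v' x - b| < ε) → u' x₁ ≤ u x₁ → v x₁ ≤ v' x₁ →
        ∀ x ≤ x₁, u' x ≤ u x ∧ v x ≤ v' x := by
  obtain ⟨φ, ψ, ε, hφ, hψ, hε, H⟩ := hw.exists_descent
  have hα := hw.alpha_pos
  refine ⟨min ε (min (ε * φ) (ε * ψ)), by positivity, ?_⟩
  intro u v u' v' h h' hz hv x₁ hnear hu1 hv1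
  -- The order is equivalent to g ≥ 0. At a negative minimum, m = -g is the least multiple of (-φ,
  -- ψ) by which the primed solution must be shifted to restore the order; the descent inequalities
  -- contradict the contact.
  let g : ℝ → ℝ := fun x => min ((u x - u' x) / φ) ((v' x - v x) / ψ)
  have cu := h.contDiff_u.continuous
  have cv := h.contDiff_v.continuous
  have cu' := h'.contDiff_u.continuous
  have cv' := h'.contDiff_v.continuous
  have cg : Continuous g := by fun_prop
  have key : ∀ x ≤ x₁, 0 ≤ g x := by
    intro x hx
    by_contra! hneg
    -- Freezing g at its value at x₁ beyond x₁ gives a function on the whole line with limits at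
    -- both ends.
    have lbot : Tendsto (fun x => g (min x x₁)) atBot (𝓝 0) := by
      have : Tendsto g atBot (𝓝 0) := by
        have := (hz.div_const φ).min (hv.div_const ψ)
        simpa using this
      refine this.congr' ?_
      filter_upwards [eventually_le_atBot x₁] with y hy
      rw [min_eq_left hy]
    have ltop : Tendsto (fun x => g (min x x₁)) atTop (𝓝 (g x₁)) := by
      refine tendsto_const_nhds.congr' ?_
      filter_upwards [eventually_ge_atTop x₁] with y hy
      rw [min_eq_right hy]
    have g1 : 0 ≤ g x₁ :=
      le_min (div_nonneg (sub_nonneg.2 hu1) hφ.le) (div_nonneg (sub_nonneg.2 hv1) hψ.le)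
    obtain ⟨y₀, hy0, hmin⟩ := exists_forall_le_of_tendsto (x₀ := x)
      (cg.comp (continuous_id.min continuous_const)) lbot ltop
      (by simpa [min_eq_left hx] using hneg) (by
        have : g x < g x₁ := hneg.trans_le g1
        simpa [min_eq_left hx] using this)
    simp only [Function.comp_apply, id, min_eq_left hx] at hy0 hmin
    set y := min y₀ x₁ with hy
    have hgy : g y < 0 := hy0.trans_lt hneg
    have hyx : y < x₁ := lt_of_le_of_ne (min_le_right _ _) (fun e => by
      rw [e] at hgy; linarith)
    have hloc : ∀ᶠ t in 𝓝 y, g y ≤ g t := by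
      filter_upwards [gt_mem_nhds hyx] with t ht
      have := hmin t
      rwa [min_eq_left (le_of_lt ht)] at this
    obtain ⟨na, nb⟩ := hnear y hyx.le
    have na' : |u' y - a| < ε := na.trans_le (min_le_left _ _)
    have nb' : |v' y - b| < ε := nb.trans_le (min_le_left _ _)
    -- Since u ≥ a and v ≤ b, closeness of the primed solution alone keeps the violation m below ε;
    -- nothing is needed about where (u, v) is.
    have hzb : -(ε * φ) < u y - u' y := by
      have := (h.mem_u y).1
      have := (abs_lt.1 (na.trans_le ((min_le_right _ _).trans (min_le_left _ _)))).2
      linarith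
    have hwb : -(ε * ψ) < v' y - v y := by
      have := (h.mem_v y).2
      have := (abs_lt.1 (nb.trans_le ((min_le_right _ _).trans (min_le_right _ _)))).1
      linarith
    have hm : -(g y) < ε := by
      have : -ε < g y := lt_min (by rw [lt_div_iff₀ hφ]; linarith) (by
        rw [lt_div_iff₀ hψ]; linarith)
      linarith
    obtain ⟨r1, r2, r3, r4, r5⟩ := H (u' y) (v' y) (-(g y)) na' nb' (by linarith) hm
    have hgu : ∀ t, g t * φ ≤ u t - u' t := fun t => (le_div_iff₀ hφ).1 (min_le_left _ _)
    have hgv : ∀ t, g t * ψ ≤ v' t - v t := fun t => (le_div_iff₀ hψ).1 (min_le_right _ _)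
    have u0 := hw.pos.trans_le (h.mem_u y).1
    have v0 := hw.pos.trans_le (h.mem_v y).1
    rcases min_choice ((u y - u' y) / φ) ((v' y - v y) / ψ) with hc | hc
    · have e : u y - u' y = g y * φ := by
        rw [show g y = (u y - u' y) / φ from hc]; field_simp
      have hlm : IsLocalMin (fun t => u t - u' t) y := by
        filter_upwards [hloc] with t ht
        rw [e]
        exact (mul_le_mul_of_nonneg_right ht hφ.le).trans (hgu t)
      have h2 := deriv_deriv_nonneg_of_isLocalMin hlm (cu.sub cu').continuousAt
      rw [deriv_deriv_sub h.contDiff_u h'.contDiff_u, h.eq_u, h'.eq_u] at h2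
      have h3 := rhsF_le_rhsF (v₂ := v' y + -(g y) * ψ) hα.le u0 v0.le
        (by linarith [hgv y]) (h.lt_mul y)
      rw [show u' y - -(g y) * φ = u y by linarith] at r1
      linarith
    · have e : v' y - v y = g y * ψ := by
        rw [show g y = (v' y - v y) / ψ from hc]; field_simp
      have hlm : IsLocalMin (fun t => v' t - v t) y := by
        filter_upwards [hloc] with t ht
        rw [e]
        exact (mul_le_mul_of_nonneg_right ht hψ.le).trans (hgv t)
      have h2 := deriv_deriv_nonneg_of_isLocalMin hlm (cv'.sub cv).continuousAt
      rw [deriv_deriv_sub h'.contDiff_v h.contDiff_v, h.eq_v, h'.eq_v] at h2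
      have h3 := rhsF_le_rhsF (v₂ := u y) hα.le r5 r4.le
        (by linarith [hgu y]) (by rw [mul_comm (v' y + _)]; exact r3)
      rw [show v' y + -(g y) * ψ = v y by linarith] at r2 h3
      linarith
  intro x hx
  have := key x hx
  have h1 : 0 ≤ (u x - u' x) / φ := this.trans (min_le_left _ _)
  have h2 : 0 ≤ (v' x - v x) / ψ := this.trans (min_le_right _ _)
  rw [le_div_iff₀ hφ, zero_mul] at h1
  rw [le_div_iff₀ hψ, zero_mul] at h2
  exact ⟨sub_nonneg.1 h1, sub_nonneg.1 h2⟩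

/-- Comparison on a half line `[x₁, ∞)` on which the upper solution is close to `(b, a)`. -/
theorem IsWellPair.exists_comparison_right {α ω a b : ℝ} (hw : IsWellPair α ω a b) :
    ∃ ε > 0, ∀ u v u' v' : ℝ → ℝ, IsBoxSolution α ω a b u v → IsBoxSolution α ω a b u' v' →
      Tendsto (fun x => u x - u' x) atTop (𝓝 0) → Tendsto (fun x => v' x - v x) atTop (𝓝 0) →
      ∀ x₁, (∀ x ≥ x₁, |u x - b| < ε ∧ |v x - a| < ε) → u' x₁ ≤ u x₁ → v x₁ ≤ v' x₁ →
        ∀ x ≥ x₁, u' x ≤ u x ∧ v x ≤ v' x := by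
  obtain ⟨ε, hε, H⟩ := hw.exists_comparison_left
  refine ⟨ε, hε, fun u v u' v' h h' hz hv x₁ hnear hu1 hv1 x hx => ?_⟩
  have := H (fun x => v' (-x)) (fun x => u' (-x)) (fun x => v (-x)) (fun x => u (-x))
    h'.swap.comp_neg h.swap.comp_neg (hv.comp tendsto_neg_atBot_atTop)
    (hz.comp tendsto_neg_atBot_atTop) (-x₁)
    (fun y hy => (hnear (-y) (by linarith)).symm) (by simpa using hv1) (by simpa using hu1)
    (-x) (by linarith)
  simp only [neg_neg] at this
  exact this.symm

/-! ### Sliding -/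

namespace IsPositiveHeteroclinic

variable {α ω a b : ℝ} {u v u' v' : ℝ → ℝ}

/-- The well (b, a) is itself a constant box solution, so touching it would make the front constant.
-/
theorem lt_right (h : IsPositiveHeteroclinic α ω a b u v) (hw : IsWellPair α ω a b) (x : ℝ) :
    u x < b ∧ a < v x := by
  have hb := h.isBoxSolution hw
  have key : ¬ (u x = b ∨ v x = a) := fun h0 => by
    have heq := (IsBoxSolution.const hw).eq_of_touch hw hb
      (fun y => ⟨(hb.mem_u y).2, (hb.mem_v y).1⟩) (x₀ := x) h0
    have h1 : Tendsto u atBot (𝓝 b) := tendsto_const_nhds.congr fun y => (heq y).1.symm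
    exact hw.lt.ne (tendsto_nhds_unique h.tendsto_u_atBot h1)
  push Not at key
  exact ⟨lt_of_le_of_ne (hb.mem_u x).2 key.1, lt_of_le_of_ne (hb.mem_v x).1 (Ne.symm key.2)⟩

/-- Sliding. The second conclusion, order for all larger translations, is kept because it yields
monotonicity when the two solutions are the same. -/
theorem exists_eq_translate (h : IsPositiveHeteroclinic α ω a b u v)
    (h' : IsPositiveHeteroclinic α ω a b u' v') (hw : IsWellPair α ω a b) :
    ∃ T, (∀ x, u' x = u (x + T) ∧ v' x = v (x + T)) ∧
      ∀ T' ≥ T, ∀ x, u' x ≤ u (x + T') ∧ v (x + T') ≤ v' x := by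
  have hb := h.isBoxSolution hw
  have hb' := h'.isBoxSolution hw
  have cu := h.contDiff_u.continuous
  have cv := h.contDiff_v.continuous
  have cu' := h'.contDiff_u.continuous
  have cv' := h'.contDiff_v.continuous
  obtain ⟨ε₁, hε₁, hleft⟩ := hw.exists_comparison_left
  obtain ⟨ε₂, hε₂, hright⟩ := hw.exists_comparison_right
  have near_left : ∀ᶠ x in atBot, |u' x - a| < ε₁ ∧ |v' x - b| < ε₁ :=
    (Metric.tendsto_nhds.1 h'.tendsto_u_atBot ε₁ hε₁).and
      (Metric.tendsto_nhds.1 h'.tendsto_v_atBot ε₁ hε₁)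
  have near_right : ∀ᶠ x in atTop, |u x - b| < ε₂ ∧ |v x - a| < ε₂ :=
    (Metric.tendsto_nhds.1 h.tendsto_u_atTop ε₂ hε₂).and
      (Metric.tendsto_nhds.1 h.tendsto_v_atTop ε₂ hε₂)
  obtain ⟨x₁, hx₁⟩ := eventually_atBot.1 near_left
  let O : ℝ → Prop := fun T => ∀ x, u' x ≤ u (x + T) ∧ v (x + T) ≤ v' x
  have order_left : ∀ T, u' x₁ ≤ u (x₁ + T) → v (x₁ + T) ≤ v' x₁ →
      ∀ x ≤ x₁, u' x ≤ u (x + T) ∧ v (x + T) ≤ v' x := fun T h1 h2 =>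
    hleft _ _ _ _ (hb.comp_add_const T) hb'
      (by simpa using (h.tendsto_u_atBot.comp (tendsto_atBot_add_const_right atBot T
        tendsto_id)).sub h'.tendsto_u_atBot)
      (by simpa using h'.tendsto_v_atBot.sub (h.tendsto_v_atBot.comp
        (tendsto_atBot_add_const_right atBot T tendsto_id))) x₁ hx₁ h1 h2
  have order_right : ∀ T y, (∀ x ≥ y + T, |u x - b| < ε₂ ∧ |v x - a| < ε₂) →
      u' y ≤ u (y + T) → v (y + T) ≤ v' y →
      ∀ x ≥ y, u' x ≤ u (x + T) ∧ v (x + T) ≤ v' x := fun T y hy h1 h2 =>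
    hright _ _ _ _ (hb.comp_add_const T) hb'
      (by simpa using (h.tendsto_u_atTop.comp (tendsto_atTop_add_const_right atTop T
        tendsto_id)).sub h'.tendsto_u_atTop)
      (by simpa using h'.tendsto_v_atTop.sub (h.tendsto_v_atTop.comp
        (tendsto_atTop_add_const_right atTop T tendsto_id))) y
      (fun x hx => hy (x + T) (by linarith)) h1 h2
  let S : Set ℝ := {T | ∀ T' ≥ T, O T'}
  have hne : S.Nonempty := by
    obtain ⟨l1, l2⟩ := h'.lt_right hw x₁
    obtain ⟨x₂, hx₂⟩ := eventually_atTop.1 (near_right.and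
      ((h.tendsto_u_atTop.eventually (lt_mem_nhds l1)).and
        (h.tendsto_v_atTop.eventually (gt_mem_nhds l2))))
    refine ⟨x₂ - x₁, fun T hT x => ?_⟩
    obtain ⟨-, h1, h2⟩ := hx₂ (x₁ + T) (by linarith)
    rcases le_total x x₁ with hx | hx
    · exact order_left T h1.le h2.le x hx
    · exact order_right T x₁ (fun y hy => (hx₂ y (by linarith)).1) h1.le h2.le x hx
  have hbdd : BddBelow S := by
    obtain ⟨x, hx⟩ := (h'.tendsto_u_atTop.eventually (lt_mem_nhds hw.lt)).exists
    have : ∀ᶠ T in atBot, u (x + T) < u' x :=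
      (h.tendsto_u_atBot.comp (tendsto_atBot_add_const_left atBot x tendsto_id)).eventually
        (gt_mem_nhds hx)
    obtain ⟨T₁, hT₁⟩ := this.exists
    refine ⟨T₁, fun T hT => ?_⟩
    by_contra! hlt
    exact absurd ((hT T₁ hlt.le x).1) (not_le.2 hT₁)
  set T := sInf S with hTdef
  have hgt : ∀ T' > T, O T' := fun T' hT' => by
    obtain ⟨T₂, h2, h3⟩ := exists_lt_of_csInf_lt hne hT'
    exact h2 T' h3.le
  have hT : O T := fun x => by
    have cu1 : Tendsto (fun t => u (x + t)) (𝓝[>] T) (𝓝 (u (x + T))) :=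
      ((cu.comp (continuous_const.add continuous_id)).tendsto T).mono_left nhdsWithin_le_nhds
    have cv1 : Tendsto (fun t => v (x + t)) (𝓝[>] T) (𝓝 (v (x + T))) :=
      ((cv.comp (continuous_const.add continuous_id)).tendsto T).mono_left nhdsWithin_le_nhds
    exact ⟨ge_of_tendsto cu1 (eventually_mem_nhdsWithin.mono fun t ht => (hgt t ht x).1),
      le_of_tendsto cv1 (eventually_mem_nhdsWithin.mono fun t ht => (hgt t ht x).2)⟩
  have hge : ∀ T' ≥ T, O T' := fun T' hT' => by
    rcases hT'.lt_or_eq with hlt | heq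
    · exact hgt T' hlt
    · exact heq ▸ hT
  refine ⟨T, ?_, hge⟩
  by_cases htouch : ∃ x, u' x = u (x + T) ∨ v' x = v (x + T)
  · obtain ⟨x₀, hx₀⟩ := htouch
    exact (hb.comp_add_const T).eq_of_touch hw hb' hT hx₀
  exfalso
  push Not at htouch
  obtain ⟨x₂, hx₂⟩ := eventually_atTop.1 near_right
  -- Without contact the order is strict on a compact interval and survives a small decrease of T.
  -- To the left of x₁ the fixed lower solution is near (a, b); to the right, every translate by t ≥
  -- T - 1 is near (b, a), so both tails are covered by comparison.
  have hcomp : ∀ᶠ t in 𝓝 T, ∀ x ∈ Set.Icc x₁ (max x₁ (x₂ - (T - 1))),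
      u' x < u (x + t) ∧ v (x + t) < v' x := by
    refine isCompact_Icc.eventually_forall_of_forall_eventually fun x _ => ?_
    have hu : u' x < u (x + T) := lt_of_le_of_ne (hT x).1 (htouch x).1
    have hv : v (x + T) < v' x := lt_of_le_of_ne (hT x).2 (Ne.symm (htouch x).2)
    have e1 : ∀ᶠ z : ℝ × ℝ in 𝓝 (T, x), u' z.2 < u (z.2 + z.1) :=
      ContinuousAt.eventually_lt (by fun_prop) (by fun_prop) hu
    have e2 : ∀ᶠ z : ℝ × ℝ in 𝓝 (T, x), v (z.2 + z.1) < v' z.2 :=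
      ContinuousAt.eventually_lt (by fun_prop) (by fun_prop) hv
    exact e1.and e2
  obtain ⟨δ, hδ, hball⟩ := Metric.eventually_nhds_iff.1 hcomp
  have hmem : T - min (δ / 2) 1 ∈ S := by
    intro t ht
    rcases le_total T t with hle | hle
    · exact hge t hle
    have hmin1 := min_le_left (δ / 2) 1
    have hmin2 := min_le_right (δ / 2) 1
    have hK := hball (y := t) (by
      rw [Real.dist_eq, abs_lt]
      constructor <;> linarith)
    intro x
    rcases le_total x x₁ with hx | hx
    · have := hK x₁ ⟨le_rfl, le_max_left _ _⟩
      exact order_left t this.1.le this.2.le x hx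
    rcases le_total x (max x₁ (x₂ - (T - 1))) with hx' | hx'
    · exact ⟨(hK x ⟨hx, hx'⟩).1.le, (hK x ⟨hx, hx'⟩).2.le⟩
    · have := hK _ ⟨le_max_left _ _, le_rfl⟩
      refine order_right t _ (fun y hy => hx₂ y ?_) this.1.le this.2.le x hx'
      have := le_max_right x₁ (x₂ - (T - 1))
      linarith
  have h1 := csInf_le hbdd hmem
  have h2 : 0 < min (δ / 2) 1 := lt_min (by linarith) one_pos
  rw [← hTdef] at h1
  linarith

/-- Comparing the solution with itself, the translation T leaves it unchanged, so domination by
translates T + h with h ≥ 0 is domination by translates h. -/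
theorem monotone_antitone (h : IsPositiveHeteroclinic α ω a b u v) (hw : IsWellPair α ω a b) :
    Monotone u ∧ Antitone v := by
  obtain ⟨T, hT, hle⟩ := h.exists_eq_translate h hw
  have key : ∀ x y, x ≤ y → u x ≤ u y ∧ v y ≤ v x := fun x y hxy => by
    have h1 := hle (T + (y - x)) (by linarith) x
    rw [show x + (T + (y - x)) = y + T by ring, ← (hT y).1, ← (hT y).2] at h1
    exact h1
  exact ⟨fun x y hxy => (key x y hxy).1, fun x y hxy => (key x y hxy).2⟩

/-- At a zero of the nonnegative function u', its minimum gives u'' = 0 and 0 ≤ u''' = F_v v'. As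
F_v > 0 and v' ≤ 0, also v' = 0, which is then a maximum of v', so v'' = 0. The point is an
equilibrium, and uniqueness makes the solution constant. -/
theorem deriv_u_pos (h : IsPositiveHeteroclinic α ω a b u v) (hw : IsWellPair α ω a b) (x : ℝ) :
    0 < deriv u x := by
  have hb := h.isBoxSolution hw
  obtain ⟨hmono, hanti⟩ := h.monotone_antitone hw
  have hu' : ∀ y, 0 ≤ deriv u y := fun y => hmono.deriv_nonneg
  have hv' : ∀ y, deriv v y ≤ 0 := fun y => hanti.deriv_nonpos
  refine lt_of_le_of_ne (hu' x) fun h0 => ?_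
  have hminu : IsLocalMin (deriv u) x := Eventually.of_forall fun y => by
    rw [← h0]; exact hu' y
  obtain ⟨u1, u2⟩ := h.contDiff_u.hasDerivAt_two x
  obtain ⟨v1, v2⟩ := h.contDiff_v.hasDerivAt_two x
  have h3 := deriv_deriv_nonneg_of_isLocalMin hminu u2.continuousAt
  have e : deriv (deriv u) = fun y => -u y * (1 - u y ^ 2 - v y ^ 2) -
      v y * (ω - α * u y * v y) := funext h.eq_u
  have hd := ((u1.neg.mul (((u1.pow 2).const_sub 1).sub (v1.pow 2))).sub
    (v1.mul (((u1.const_mul α).mul v1).const_sub ω))).deriv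
  have e3 : deriv (deriv (deriv u)) x = (2 * (1 + α) * (u x * v x) - ω) * deriv v x := by
    rw [e]
    refine Eq.trans hd ?_
    simp only [← h0]
    push_cast
    simp only [Pi.neg_apply, Pi.sub_apply, Pi.pow_apply, Pi.mul_apply]
    ring
  have hp := h.lt_mul hw x
  have hα := hw.alpha_pos
  have huv := mul_pos (h.pos_u x) (h.pos_v x)
  have hk : 0 < 2 * (1 + α) * (u x * v x) - ω := by nlinarith
  have hv0 : deriv v x = 0 := by
    refine le_antisymm (hv' x) ?_
    rw [e3] at h3
    exact nonneg_of_mul_nonneg_right h3 hk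
  have hmaxv : IsLocalMax (deriv v) x := Eventually.of_forall fun y => by
    rw [hv0]; exact hv' y
  have F0 : 0 = rhsF α ω (u x) (v x) := by rw [← h.eq_u]; exact hminu.deriv_eq_zero.symm
  have G0 : 0 = rhsF α ω (v x) (u x) := by
    rw [← rhsG_eq_rhsF, ← h.eq_v]; exact hmaxv.deriv_eq_zero.symm
  have hconst : IsBoxSolution α ω a b (fun _ => u x) (fun _ => v x) :=
    ⟨contDiff_const, contDiff_const, by simpa using F0, by simpa using G0,
      fun _ => hb.mem_u x, fun _ => hb.mem_v x, fun _ => hp⟩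
  have heq := hconst.eq_of_initial hb (x₀ := x) rfl rfl (by simp [← h0]) (by simp [hv0])
  have h1 : Tendsto u atBot (𝓝 (u x)) := tendsto_const_nhds.congr fun y => (heq y).1.symm
  have h2 : Tendsto u atTop (𝓝 (u x)) := tendsto_const_nhds.congr fun y => (heq y).1.symm
  have := tendsto_nhds_unique h.tendsto_u_atBot h1
  have := tendsto_nhds_unique h.tendsto_u_atTop h2
  linarith [hw.lt]

theorem deriv_v_neg (h : IsPositiveHeteroclinic α ω a b u v) (hw : IsWellPair α ω a b) (x : ℝ) :
    deriv v x < 0 := by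
  have := h.reflect.deriv_u_pos hw (-x)
  rw [deriv_comp_neg, neg_neg] at this
  linarith

end IsPositiveHeteroclinic

/-! ### The resolvent of the one-dimensional Laplacian -/

open MeasureTheory

theorem contDiff_two_of_hasDerivAt {f f' f'' : ℝ → ℝ} (h1 : ∀ x, HasDerivAt f (f' x) x)
    (h2 : ∀ x, HasDerivAt f' (f'' x) x) (hc : Continuous f'') :
    ContDiff ℝ 2 f ∧ deriv (deriv f) = f'' := by
  have e1 : deriv f = f' := funext fun x => (h1 x).deriv
  have e2 : deriv f' = f'' := funext fun x => (h2 x).deriv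
  refine ⟨?_, by rw [e1, e2]⟩
  have c1 : ContDiff ℝ 1 f' := by
    refine contDiff_one_iff_deriv.2 ⟨fun x => (h2 x).differentiableAt, by rwa [e2]⟩
  have : ContDiff ℝ (1 + 1) f := contDiff_succ_iff_deriv.2
    ⟨fun x => (h1 x).differentiableAt, by simp, by rwa [e1]⟩
  simpa [one_add_one_eq_two] using this

/-- A bounded subsolution of `y'' = κ² y` is nonpositive. -/
theorem nonpos_of_deriv_deriv_ge {y : ℝ → ℝ} {κ M : ℝ} (hκ : 0 < κ) (hy : ContDiff ℝ 2 y)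
    (hM : ∀ x, y x ≤ M) (h : ∀ x, κ ^ 2 * y x ≤ deriv (deriv y) x) (x : ℝ) : y x ≤ 0 := by
  have key : ∀ δ > 0, y x ≤ δ * (κ ^ 2 * x ^ 2 + 2) := by
    intro δ hδ
    -- Barrier with q'' = 2δκ² and q ≥ 2δ: at a maximum of y - q one gets y ≤ 2δ ≤ q.
    let q : ℝ → ℝ := fun t => δ * (κ ^ 2 * t ^ 2 + 2)
    have hq : ContDiff ℝ 2 q := by fun_prop
    have hq2 : ∀ t, deriv (deriv q) t = 2 * δ * κ ^ 2 := by
      intro t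
      have e1 : deriv q = fun t => 2 * δ * κ ^ 2 * t := funext fun t => by
        have := ((((hasDerivAt_id t).pow 2).const_mul (κ ^ 2)).add_const 2).const_mul δ
        refine this.deriv.trans ?_
        simp
        ring
      rw [e1]
      simp
    have hev : ∀ᶠ t in cocompact ℝ, (fun t => y t - q t) t ≤ (fun t => y t - q t) x := by
      have hc : 0 < δ * κ ^ 2 := by positivity
      have := (tendsto_norm_cocompact_atTop (E := ℝ)).eventually_ge_atTop
        (1 + |M - (y x - q x)| / (δ * κ ^ 2))
      filter_upwards [this] with t ht
      have h0 : 0 ≤ |M - (y x - q x)| / (δ * κ ^ 2) := by positivity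
      have h1 : |M - (y x - q x)| / (δ * κ ^ 2) ≤ t ^ 2 := by
        set r := |M - (y x - q x)| / (δ * κ ^ 2)
        have ht' : 1 + r ≤ |t| := ht
        rw [← sq_abs t]
        nlinarith
      rw [div_le_iff₀ hc] at h1
      have h2 := le_abs_self (M - (y x - q x))
      have h3 := hM t
      simp only [q] at *
      nlinarith
    obtain ⟨t, ht⟩ := (hy.continuous.sub hq.continuous).exists_forall_ge' x hev
    have hmax : IsLocalMax (fun t => y t - q t) t := Eventually.of_forall ht
    have h2 := deriv_deriv_nonpos_of_isLocalMax hmax (hy.continuous.sub hq.continuous).continuousAt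
    rw [deriv_deriv_sub hy hq, hq2] at h2
    have h3 := h t
    have h4 : κ ^ 2 * (y t - 2 * δ) ≤ 0 := by linarith
    have h5 : y t - 2 * δ ≤ 0 := nonpos_of_mul_nonpos_right h4 (by positivity)
    have h6 : y x - q x ≤ y t - q t := ht x
    have h7 : 0 ≤ δ * (κ ^ 2 * t ^ 2) := by positivity
    simp only [q] at h6
    linarith
  have hlim : Tendsto (fun δ : ℝ => δ * (κ ^ 2 * x ^ 2 + 2)) (𝓝[>] 0) (𝓝 0) := by
    have : Tendsto (fun δ : ℝ => δ * (κ ^ 2 * x ^ 2 + 2)) (𝓝 0) (𝓝 (0 * (κ ^ 2 * x ^ 2 + 2))) :=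
      tendsto_id.mul_const _
    rw [zero_mul] at this
    exact this.mono_left nhdsWithin_le_nhds
  exact ge_of_tendsto hlim (eventually_mem_nhdsWithin.mono fun δ hδ => key δ hδ)

/-- The Green function of `1 - κ⁻² d²/dx²` on the line. -/
noncomputable def greenKernel (κ x : ℝ) : ℝ := κ / 2 * Real.exp (-κ * |x|)

/-- The bounded solution `z` of `z'' = κ² (z - H)`. -/
noncomputable def greenOp (κ : ℝ) (H : ℝ → ℝ) (x : ℝ) : ℝ := ∫ y, greenKernel κ (x - y) * H y

section Kernel

variable {κ : ℝ}

theorem greenKernel_nonneg (hκ : 0 < κ) (x : ℝ) : 0 ≤ greenKernel κ x := by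
  unfold greenKernel; positivity

theorem continuous_greenKernel (κ : ℝ) : Continuous (greenKernel κ) := by
  unfold greenKernel; fun_prop

theorem greenKernel_neg (κ x : ℝ) : greenKernel κ (-x) = greenKernel κ x := by
  simp [greenKernel]

theorem greenKernel_le_of_abs_le (hκ : 0 < κ) {x y : ℝ} (h : |x| ≤ |y|) :
    greenKernel κ y ≤ greenKernel κ x := by
  unfold greenKernel
  have := mul_le_mul_of_nonneg_left h hκ.le
  gcongr ?_ * Real.exp ?_
  linarith

theorem integral_greenKernel (hκ : 0 < κ) : ∫ x, greenKernel κ x = 1 := by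
  have h1 := integral_comp_abs (f := fun x => κ / 2 * Real.exp (-κ * x))
  unfold greenKernel
  rw [h1, integral_const_mul, integral_exp_mul_Ioi (by linarith)]
  simp
  field_simp

theorem integrable_greenKernel (hκ : 0 < κ) : Integrable (greenKernel κ) :=
  integrable_of_integral_eq_one (integral_greenKernel hκ)

theorem integral_greenKernel_sub (hκ : 0 < κ) (x : ℝ) : ∫ y, greenKernel κ (x - y) = 1 := by
  rw [integral_sub_left_eq_self (greenKernel κ), integral_greenKernel hκ]

theorem integrable_greenKernel_sub (hκ : 0 < κ) (x : ℝ) :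
    Integrable fun y => greenKernel κ (x - y) := (integrable_greenKernel hκ).comp_sub_left x

theorem integrable_greenKernel_mul (hκ : 0 < κ) {H : ℝ → ℝ} {M : ℝ} (hH : Measurable H)
    (hM : ∀ y, |H y| ≤ M) (x : ℝ) : Integrable fun y => greenKernel κ (x - y) * H y :=
  (integrable_greenKernel_sub hκ x).mul_bdd (c := M) hH.aestronglyMeasurable
    (Eventually.of_forall hM)

theorem greenOp_eq (κ : ℝ) (H : ℝ → ℝ) (x : ℝ) :
    greenOp κ H x = ∫ y, greenKernel κ y * H (x - y) := by
  rw [greenOp, ← integral_sub_left_eq_self _ volume x]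
  simp

theorem greenOp_const (hκ : 0 < κ) (c x : ℝ) : greenOp κ (fun _ => c) x = c := by
  rw [greenOp, integral_mul_const, integral_greenKernel_sub hκ, one_mul]

theorem greenOp_mono (hκ : 0 < κ) {H H' : ℝ → ℝ} {M : ℝ} (hH : Measurable H)
    (hM : ∀ y, |H y| ≤ M) (hH' : Measurable H') (hM' : ∀ y, |H' y| ≤ M) (h : ∀ y, H y ≤ H' y)
    (x : ℝ) : greenOp κ H x ≤ greenOp κ H' x :=
  integral_mono (integrable_greenKernel_mul hκ hH hM x) (integrable_greenKernel_mul hκ hH' hM' x)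
    fun y => mul_le_mul_of_nonneg_left (h y) (greenKernel_nonneg hκ _)

theorem greenOp_add (hκ : 0 < κ) {H H' : ℝ → ℝ} {M M' : ℝ} (hH : Measurable H)
    (hM : ∀ y, |H y| ≤ M) (hH' : Measurable H') (hM' : ∀ y, |H' y| ≤ M') (x : ℝ) :
    greenOp κ (fun y => H y + H' y) x = greenOp κ H x + greenOp κ H' x := by
  rw [greenOp, greenOp, greenOp, ← integral_add (integrable_greenKernel_mul hκ hH hM x)
    (integrable_greenKernel_mul hκ hH' hM' x)]
  simp only [mul_add]

theorem greenOp_const_mul (κ c : ℝ) (H : ℝ → ℝ) (x : ℝ) :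
    greenOp κ (fun y => c * H y) x = c * greenOp κ H x := by
  rw [greenOp, greenOp, ← integral_const_mul]
  congr 1
  ext y
  ring

theorem greenOp_neg (κ : ℝ) (H : ℝ → ℝ) (x : ℝ) :
    greenOp κ (fun y => H (-y)) x = greenOp κ H (-x) := by
  rw [greenOp, greenOp, ← integral_neg_eq_self]
  congr 1
  ext y
  rw [← greenKernel_neg]
  simp only [neg_neg]
  congr 2
  ring

theorem greenOp_le (hκ : 0 < κ) {H : ℝ → ℝ} {M c : ℝ} (hH : Measurable H)
    (hM : ∀ y, |H y| ≤ M) (h : ∀ y, H y ≤ c) (x : ℝ) : greenOp κ H x ≤ c := by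
  rw [← greenOp_const hκ c x]
  exact greenOp_mono hκ (M := max M |c|) hH (fun y => (hM y).trans (le_max_left _ _))
    measurable_const (fun _ => le_max_right _ _) h x

theorem le_greenOp (hκ : 0 < κ) {H : ℝ → ℝ} {M c : ℝ} (hH : Measurable H)
    (hM : ∀ y, |H y| ≤ M) (h : ∀ y, c ≤ H y) (x : ℝ) : c ≤ greenOp κ H x := by
  rw [← greenOp_const hκ c x]
  exact greenOp_mono hκ (M := max M |c|) measurable_const (fun _ => le_max_right _ _) hH
    (fun y => (hM y).trans (le_max_left _ _)) h x

/-- Pairing `y` with its mirror image `c - y`. -/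
theorem integral_nonneg_of_add_reflect {f : ℝ → ℝ} (hf : Integrable f) (c : ℝ)
    (h : ∀ y, 0 ≤ f y + f (c - y)) : 0 ≤ ∫ y, f y := by
  have h1 : ∫ y, (f y + f (c - y)) = 2 * ∫ y, f y := by
    rw [integral_add hf (hf.comp_sub_left c), integral_sub_left_eq_self f volume c]
    ring
  have h2 : 0 ≤ ∫ y, (f y + f (c - y)) := integral_nonneg h
  linarith

theorem greenOp_monotone (hκ : 0 < κ) {H : ℝ → ℝ} {M : ℝ} (hM : ∀ y, |H y| ≤ M)
    (hmono : Monotone H) : Monotone (greenOp κ H) := by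
  intro x x' hx
  rw [greenOp_eq, greenOp_eq]
  have hi : ∀ x, Integrable fun y => greenKernel κ y * H (x - y) := fun x =>
    (integrable_greenKernel hκ).mul_bdd (c := M)
      (hmono.measurable.comp (measurable_const.sub measurable_id)).aestronglyMeasurable
      (Eventually.of_forall fun y => hM _)
  exact integral_mono (hi x) (hi x') fun y =>
    mul_le_mul_of_nonneg_left (hmono (by linarith)) (greenKernel_nonneg hκ _)

/-- The resolvent preserves order on `[0, ∞)` between odd functions. -/
theorem greenOp_mono_of_odd (hκ : 0 < κ) {H H' : ℝ → ℝ} {M : ℝ} (hH : Measurable H)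
    (hM : ∀ y, |H y| ≤ M) (hH' : Measurable H') (hM' : ∀ y, |H' y| ≤ M)
    (ho : ∀ y, H (-y) = -H y) (ho' : ∀ y, H' (-y) = -H' y) (h : ∀ y, 0 ≤ y → H y ≤ H' y)
    {x : ℝ} (hx : 0 ≤ x) : greenOp κ H x ≤ greenOp κ H' x := by
  have i1 := integrable_greenKernel_mul hκ hH hM x
  have i2 := integrable_greenKernel_mul hκ hH' hM' x
  rw [← sub_nonneg, greenOp, greenOp, ← integral_sub i2 i1]
  refine integral_nonneg_of_add_reflect (i2.sub i1) 0 fun y => ?_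
  simp only [zero_sub, ho, ho', sub_neg_eq_add]
  have e : greenKernel κ (x - y) * H' y - greenKernel κ (x - y) * H y +
      (greenKernel κ (x + y) * -H' y - greenKernel κ (x + y) * -H y) =
      (greenKernel κ (x - y) - greenKernel κ (x + y)) * (H' y - H y) := by ring
  rw [e]
  rcases le_total 0 y with hy | hy
  · refine mul_nonneg (sub_nonneg.2 (greenKernel_le_of_abs_le hκ ?_)) (sub_nonneg.2 (h y hy))
    rw [← sq_le_sq]; nlinarith
  · refine mul_nonneg_of_nonpos_of_nonpos (sub_nonpos.2 (greenKernel_le_of_abs_le hκ ?_)) ?_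
    · rw [← sq_le_sq]; nlinarith
    · have := h (-y) (by linarith)
      rw [ho, ho'] at this
      linarith

/-- The resolvent preserves even functions that are monotone on `[0, ∞)`. -/
theorem greenOp_monotoneOn_of_even (hκ : 0 < κ) {H : ℝ → ℝ} {M : ℝ} (hH : Measurable H)
    (hM : ∀ y, |H y| ≤ M) (he : ∀ y z, |y| ≤ |z| → H y ≤ H z) :
    ∀ x x', |x| ≤ |x'| → greenOp κ H x ≤ greenOp κ H x' := by
  have heven : ∀ x, greenOp κ H (-x) = greenOp κ H x := fun x => by
    rw [← greenOp_neg]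
    congr 1
    ext y
    exact le_antisymm (he _ _ (by simp)) (he _ _ (by simp))
  have habs : ∀ x, greenOp κ H |x| = greenOp κ H x := fun x => by
    rcases abs_choice x with h | h <;> rw [h]
    exact heven x
  have key : ∀ x x', 0 ≤ x → x ≤ x' → greenOp κ H x ≤ greenOp κ H x' := by
    intro x x' hx hxx'
    have i1 := integrable_greenKernel_mul hκ hH hM x
    have i2 := integrable_greenKernel_mul hκ hH hM x'
    rw [← sub_nonneg, greenOp, greenOp, ← integral_sub i2 i1]
    refine integral_nonneg_of_add_reflect (i2.sub i1) (x + x') fun y => ?_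
    have e1 : greenKernel κ (x' - (x + x' - y)) = greenKernel κ (x - y) := by
      rw [← greenKernel_neg]; congr 1; ring
    have e2 : greenKernel κ (x - (x + x' - y)) = greenKernel κ (x' - y) := by
      rw [← greenKernel_neg]; congr 1; ring
    rw [e1, e2]
    have e : greenKernel κ (x' - y) * H y - greenKernel κ (x - y) * H y +
      (greenKernel κ (x - y) * H (x + x' - y) - greenKernel κ (x' - y) * H (x + x' - y)) =
      (greenKernel κ (x' - y) - greenKernel κ (x - y)) * (H y - H (x + x' - y)) := by ring
    rw [e]
    rcases le_total (x + x') (2 * y) with hy | hy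
    · refine mul_nonneg (sub_nonneg.2 (greenKernel_le_of_abs_le hκ ?_)) (sub_nonneg.2 (he _ _ ?_))
        <;> rw [← sq_le_sq] <;> nlinarith
    · refine mul_nonneg_of_nonpos_of_nonpos (sub_nonpos.2 (greenKernel_le_of_abs_le hκ ?_))
        (sub_nonpos.2 (he _ _ ?_)) <;> rw [← sq_le_sq] <;> nlinarith
  intro x x' hx
  rw [← habs x, ← habs x']
  exact key _ _ (abs_nonneg _) hx

theorem tendsto_greenOp_atTop (hκ : 0 < κ) {H : ℝ → ℝ} {M l : ℝ} (hH : Measurable H)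
    (hM : ∀ y, |H y| ≤ M) (hl : Tendsto H atTop (𝓝 l)) :
    Tendsto (greenOp κ H) atTop (𝓝 l) := by
  have e : greenOp κ H = fun x => ∫ y, greenKernel κ y * H (x - y) := funext (greenOp_eq κ H)
  have hl' : (∫ y, greenKernel κ y * l) = l := by
    rw [integral_mul_const, integral_greenKernel hκ, one_mul]
  rw [e, ← hl']
  refine tendsto_integral_filter_of_dominated_convergence (fun y => greenKernel κ y * M) ?_ ?_
    ((integrable_greenKernel hκ).mul_const M) ?_
  · exact Eventually.of_forall fun x => ((continuous_greenKernel κ).measurable.mul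
      (hH.comp (measurable_const.sub measurable_id))).aestronglyMeasurable
  · refine Eventually.of_forall fun x => Eventually.of_forall fun y => ?_
    rw [norm_mul, Real.norm_of_nonneg (greenKernel_nonneg hκ y)]
    exact mul_le_mul_of_nonneg_left (hM _) (greenKernel_nonneg hκ y)
  · refine Eventually.of_forall fun y => (hl.comp ?_).const_mul _
    exact tendsto_atTop_add_const_right atTop (-y) tendsto_id

theorem tendsto_greenOp_of_tendsto (hκ : 0 < κ) {H : ℕ → ℝ → ℝ} {H' : ℝ → ℝ} {M : ℝ}
    (hH : ∀ n, Measurable (H n)) (hM : ∀ n y, |H n y| ≤ M)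
    (hl : ∀ y, Tendsto (fun n => H n y) atTop (𝓝 (H' y))) (x : ℝ) :
    Tendsto (fun n => greenOp κ (H n) x) atTop (𝓝 (greenOp κ H' x)) := by
  refine tendsto_integral_of_dominated_convergence (fun y => greenKernel κ (x - y) * M)
    (fun n => (integrable_greenKernel_mul hκ (hH n) (hM n) x).aestronglyMeasurable)
    ((integrable_greenKernel_sub hκ x).mul_const M) (fun n => Eventually.of_forall fun y => ?_)
    (Eventually.of_forall fun y => (hl y).const_mul _)
  rw [norm_mul, Real.norm_of_nonneg (greenKernel_nonneg hκ _)]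
  exact mul_le_mul_of_nonneg_left (hM _ _) (greenKernel_nonneg hκ _)

/-- The resolvent written with two primitives. -/
theorem exists_greenOp_eq_primitive (hκ : 0 < κ) {H : ℝ → ℝ} {M : ℝ} (hH : Measurable H)
    (hM : ∀ y, |H y| ≤ M) : ∃ c₁ c₂ : ℝ,
      (∀ s t, IntervalIntegrable (fun y => Real.exp (κ * y) * H y) volume s t) ∧
      (∀ s t, IntervalIntegrable (fun y => Real.exp (-κ * y) * H y) volume s t) ∧
      ∀ x, greenOp κ H x = κ / 2 *
        (Real.exp (-κ * x) * (c₁ + ∫ y in (0 : ℝ)..x, Real.exp (κ * y) * H y) +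
          Real.exp (κ * x) * (c₂ - ∫ y in (0 : ℝ)..x, Real.exp (-κ * y) * H y)) := by
  have e1 : ∀ x, ∀ y ∈ Set.Iic x, greenKernel κ (x - y) * H y =
      κ / 2 * Real.exp (-κ * x) * (Real.exp (κ * y) * H y) := fun x y hy => by
    rw [greenKernel, abs_of_nonneg (sub_nonneg.2 hy), show -κ * (x - y) = -κ * x + κ * y by ring,
      Real.exp_add]
    ring
  have e2 : ∀ x, ∀ y ∈ Set.Ioi x, greenKernel κ (x - y) * H y =
      κ / 2 * Real.exp (κ * x) * (Real.exp (-κ * y) * H y) := fun x y hy => by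
    rw [greenKernel, abs_of_nonpos (sub_nonpos.2 (le_of_lt hy)),
      show -κ * -(x - y) = κ * x + -κ * y by ring, Real.exp_add]
    ring
  have i1 : ∀ x, IntegrableOn (fun y => Real.exp (κ * y) * H y) (Set.Iic x) := fun x => by
    have h := (integrable_greenKernel_mul hκ hH hM x).integrableOn (s := Set.Iic x)
    rw [integrableOn_congr_fun (e1 x) measurableSet_Iic] at h
    exact (integrable_const_mul_iff (IsUnit.mk0 _ (by positivity)) _).1 h
  have i2 : ∀ x, IntegrableOn (fun y => Real.exp (-κ * y) * H y) (Set.Ioi x) := fun x => by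
    have h := (integrable_greenKernel_mul hκ hH hM x).integrableOn (s := Set.Ioi x)
    rw [integrableOn_congr_fun (e2 x) measurableSet_Ioi] at h
    exact (integrable_const_mul_iff (IsUnit.mk0 _ (by positivity)) _).1 h
  refine ⟨∫ y in Set.Iic 0, Real.exp (κ * y) * H y, ∫ y in Set.Ioi 0, Real.exp (-κ * y) * H y,
    fun s t => ?_, fun s t => ?_, fun x => ?_⟩
  · exact (intervalIntegrable_iff.2 ((i1 (max s t)).mono_set fun y hy => hy.2))
  · exact (intervalIntegrable_iff.2 ((i2 (min s t)).mono_set fun y hy => hy.1))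
  · rw [← intervalIntegral.integral_Iic_sub_Iic (i1 0) (i1 x),
      ← intervalIntegral.integral_Ioi_sub_Ioi' (i2 0) (i2 x), greenOp,
      ← intervalIntegral.integral_Iic_add_Ioi
        (integrable_greenKernel_mul hκ hH hM x).integrableOn
        (integrable_greenKernel_mul hκ hH hM x).integrableOn,
      setIntegral_congr_fun measurableSet_Iic (e1 x), setIntegral_congr_fun measurableSet_Ioi (e2 x),
      integral_const_mul, integral_const_mul]
    ring

theorem continuous_greenOp (hκ : 0 < κ) {H : ℝ → ℝ} {M : ℝ} (hH : Measurable H)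
    (hM : ∀ y, |H y| ≤ M) : Continuous (greenOp κ H) := by
  obtain ⟨c₁, c₂, i1, i2, h⟩ := exists_greenOp_eq_primitive hκ hH hM
  rw [show greenOp κ H = _ from funext h]
  have := intervalIntegral.continuous_primitive i1 0
  have := intervalIntegral.continuous_primitive i2 0
  fun_prop

theorem greenOp_contDiff (hκ : 0 < κ) {H : ℝ → ℝ} {M : ℝ} (hH : Continuous H)
    (hM : ∀ y, |H y| ≤ M) : ContDiff ℝ 2 (greenOp κ H) ∧
      ∀ x, deriv (deriv (greenOp κ H)) x = κ ^ 2 * (greenOp κ H x - H x) := by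
  obtain ⟨c₁, c₂, -, -, h⟩ := exists_greenOp_eq_primitive hκ hH.measurable hM
  set E₁ : ℝ → ℝ := fun x => Real.exp (-κ * x) *
    (c₁ + ∫ y in (0 : ℝ)..x, Real.exp (κ * y) * H y) with hE₁
  set E₂ : ℝ → ℝ := fun x => Real.exp (κ * x) *
    (c₂ - ∫ y in (0 : ℝ)..x, Real.exp (-κ * y) * H y) with hE₂
  have h' : greenOp κ H = fun x => κ / 2 * (E₁ x + E₂ x) := funext h
  have d1 : ∀ x, HasDerivAt E₁ (-κ * E₁ x + H x) x := fun x => by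
    have p := ((by fun_prop : Continuous fun y => Real.exp (κ * y) * H y).integral_hasStrictDerivAt
      0 x).hasDerivAt.const_add c₁
    have q := ((hasDerivAt_id x).const_mul (-κ)).exp
    refine (q.mul p).congr_deriv ?_
    have : Real.exp (-κ * x) * Real.exp (κ * x) = 1 := by rw [← Real.exp_add]; simp
    simp only [hE₁, id]
    linear_combination H x * this
  have d2 : ∀ x, HasDerivAt E₂ (κ * E₂ x - H x) x := fun x => by
    have p := ((by fun_prop : Continuous fun y => Real.exp (-κ * y) * H y).integral_hasStrictDerivAt
      0 x).hasDerivAt.const_sub c₂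
    have q := ((hasDerivAt_id x).const_mul κ).exp
    refine (q.mul p).congr_deriv ?_
    have : Real.exp (-κ * x) * Real.exp (κ * x) = 1 := by rw [← Real.exp_add]; simp
    simp only [hE₂, id]
    linear_combination (-H x) * this
  have hc : Continuous (greenOp κ H) := continuous_greenOp hκ hH.measurable hM
  obtain ⟨r1, r2⟩ := contDiff_two_of_hasDerivAt (f := greenOp κ H)
    -- The two occurrences of H cancel, so the first derivative can be differentiated again although
    -- H is only continuous.
    (f' := fun x => κ / 2 * (-κ * E₁ x + H x + (κ * E₂ x - H x)))
    (f'' := fun x => κ ^ 2 * (greenOp κ H x - H x))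
    (fun x => by rw [h']; exact ((d1 x).add (d2 x)).const_mul _)
    (fun x => by
      have e : (fun x => κ / 2 * (-κ * E₁ x + H x + (κ * E₂ x - H x))) =
          fun x => κ / 2 * (-κ * E₁ x + κ * E₂ x) := by ext x; ring
      rw [e, h']
      refine ((((d1 x).const_mul (-κ)).add ((d2 x).const_mul κ)).const_mul _).congr_deriv ?_
      ring)
    (by fun_prop)
  exact ⟨r1, fun x => congrFun r2 x⟩

/-- A bounded subsolution lies below the resolvent. -/
theorem le_greenOp_of_deriv_deriv_ge (hκ : 0 < κ) {H φ : ℝ → ℝ} {M : ℝ} (hH : Continuous H)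
    (hM : ∀ y, |H y| ≤ M) (hφ : ContDiff ℝ 2 φ) {C : ℝ} (hC : ∀ x, φ x ≤ C)
    (h : ∀ x, κ ^ 2 * (φ x - H x) ≤ deriv (deriv φ) x) (x : ℝ) : φ x ≤ greenOp κ H x := by
  obtain ⟨r1, r2⟩ := greenOp_contDiff hκ hH hM
  have := nonpos_of_deriv_deriv_ge (y := fun x => φ x - greenOp κ H x) (M := C - -M) hκ
    (hφ.sub r1) (fun x => sub_le_sub (hC x) (le_greenOp hκ hH.measurable hM
      (fun y => (abs_le.1 (hM y)).1) x))
    (fun x => by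
      rw [deriv_deriv_sub hφ r1, r2]
      linarith [h x]) x
  exact sub_nonpos.1 this

end Kernel

/-! ### Monotone iteration for cooperative pairs -/

/-- A pair of nonlinearities, nondecreasing in both variables on `[0, 1]²`, fixing `(1, 1)`, the
first odd and the second even in the first variable. -/
structure IsCooperativePair (h₁ h₂ : ℝ → ℝ → ℝ) : Prop where
  cont₁ : Continuous fun p : ℝ × ℝ => h₁ p.1 p.2
  cont₂ : Continuous fun p : ℝ × ℝ => h₂ p.1 p.2
  odd : ∀ t s, h₁ (-t) s = -h₁ t s
  even : ∀ t s, h₂ (-t) s = h₂ t s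
  mono₁ : ∀ t t' s s', 0 ≤ t → t ≤ t' → t' ≤ 1 → 0 ≤ s → s ≤ s' → s' ≤ 1 → h₁ t s ≤ h₁ t' s'
  mono₂ : ∀ t t' s s', 0 ≤ t → t ≤ t' → t' ≤ 1 → 0 ≤ s → s ≤ s' → s' ≤ 1 → h₂ t s ≤ h₂ t' s'
  fix₁ : h₁ 1 1 = 1
  fix₂ : h₂ 1 1 = 1
  nonneg₂ : 0 ≤ h₂ 0 0

/-- Odd monotone profiles bounded by `1`, with an even companion monotone in `|x|`. -/
structure IsProfile (τ σ : ℝ → ℝ) : Prop where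
  odd : ∀ x, τ (-x) = -τ x
  mono : Monotone τ
  le_one : ∀ x, τ x ≤ 1
  meas : Measurable σ
  even_mono : ∀ x y, |x| ≤ |y| → σ x ≤ σ y
  nonneg' : ∀ x, 0 ≤ σ x
  le_one' : ∀ x, σ x ≤ 1

namespace IsProfile

variable {τ σ τ' σ' : ℝ → ℝ} {h₁ h₂ : ℝ → ℝ → ℝ} {κ : ℝ}

theorem map_zero (p : IsProfile τ σ) : τ 0 = 0 := by
  have := p.odd 0
  rw [neg_zero] at this
  linarith

theorem nonneg (p : IsProfile τ σ) {x : ℝ} (hx : 0 ≤ x) : 0 ≤ τ x := by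
  rw [← p.map_zero]; exact p.mono hx

theorem abs_eq (p : IsProfile τ σ) (x : ℝ) : |τ x| = τ |x| := by
  rcases le_total 0 x with hx | hx
  · rw [abs_of_nonneg hx, abs_of_nonneg (p.nonneg hx)]
  · have := p.nonneg (neg_nonneg.2 hx)
    rw [p.odd] at this
    rw [abs_of_nonpos hx, p.odd, abs_of_nonpos (by linarith)]

theorem even (p : IsProfile τ σ) (x : ℝ) : σ (-x) = σ x :=
  le_antisymm (p.even_mono _ _ (by simp)) (p.even_mono _ _ (by simp))

theorem sign : IsProfile Real.sign fun _ => 1 where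
  odd x := Real.sign_neg
  mono x y hxy := by
    rcases lt_trichotomy x 0 with hx | rfl | hx
    · rw [Real.sign_of_neg hx]
      rcases Real.sign_apply_eq y with h | h | h <;> rw [h] <;> norm_num
    · rw [Real.sign_zero]
      rcases hxy.eq_or_lt with rfl | h
      · simp
      · rw [Real.sign_of_pos h]; norm_num
    · rw [Real.sign_of_pos hx, Real.sign_of_pos (hx.trans_le hxy)]
  le_one x := by rcases Real.sign_apply_eq x with h | h | h <;> rw [h] <;> norm_num
  meas := measurable_const
  even_mono _ _ _ := le_rfl
  nonneg' _ := zero_le_one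
  le_one' _ := le_rfl

theorem rhs_odd (p : IsProfile τ σ) (H : IsCooperativePair h₁ h₂) (x : ℝ) :
    h₁ (τ (-x)) (σ (-x)) = -h₁ (τ x) (σ x) := by
  rw [p.odd, p.even, H.odd]

theorem rhs_zero (H : IsCooperativePair h₁ h₂) (s : ℝ) : h₁ 0 s = 0 := by
  have := H.odd 0 s
  rw [neg_zero] at this
  linarith

/-- Monotonicity of h₁ is assumed only for nonnegative arguments; oddness carries it to the negative
half line, where σ decreases. -/
theorem rhs_mono (p : IsProfile τ σ) (H : IsCooperativePair h₁ h₂) :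
    Monotone fun x => h₁ (τ x) (σ x) := by
  have key : ∀ x y, 0 ≤ x → x ≤ y → h₁ (τ x) (σ x) ≤ h₁ (τ y) (σ y) := fun x y hx hxy =>
    H.mono₁ _ _ _ _ (p.nonneg hx) (p.mono hxy) (p.le_one y) (p.nonneg' x)
      (p.even_mono _ _ (by rwa [abs_of_nonneg hx, abs_of_nonneg (hx.trans hxy)])) (p.le_one' y)
  have h0 : h₁ (τ 0) (σ 0) = 0 := by rw [p.map_zero, rhs_zero H]
  have key' : ∀ x y, y ≤ 0 → x ≤ y → h₁ (τ x) (σ x) ≤ h₁ (τ y) (σ y) := fun x y hy hxy => by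
    have := key (-y) (-x) (by linarith) (by linarith)
    rw [p.rhs_odd H, p.rhs_odd H] at this
    linarith
  intro x y hxy
  rcases le_total 0 x with hx | hx
  · exact key x y hx hxy
  rcases le_total 0 y with hy | hy
  · have h1 := key 0 y le_rfl hy
    have h2 := key' x 0 le_rfl hx
    exact h2.trans h1
  · exact key' x y hy hxy

theorem rhs_le_one (p : IsProfile τ σ) (H : IsCooperativePair h₁ h₂) (x : ℝ) :
    h₁ (τ x) (σ x) ≤ 1 := by
  refine (p.rhs_mono H (le_abs_self x)).trans ?_
  rw [← H.fix₁]
  exact H.mono₁ _ _ _ _ (p.nonneg (abs_nonneg x)) (p.le_one _) le_rfl (p.nonneg' _)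
    (p.le_one' _) le_rfl

theorem abs_rhs_le (p : IsProfile τ σ) (H : IsCooperativePair h₁ h₂) (x : ℝ) :
    |h₁ (τ x) (σ x)| ≤ 1 := by
  refine abs_le.2 ⟨?_, p.rhs_le_one H x⟩
  have := p.rhs_le_one H (-x)
  rw [p.rhs_odd H] at this
  linarith

theorem rhs'_abs (p : IsProfile τ σ) (H : IsCooperativePair h₁ h₂) (x : ℝ) :
    h₂ (τ x) (σ x) = h₂ (τ |x|) (σ x) := by
  rw [← p.abs_eq]
  rcases abs_choice (τ x) with h | h <;> rw [h]
  rw [H.even]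

theorem rhs'_even_mono (p : IsProfile τ σ) (H : IsCooperativePair h₁ h₂) (x y : ℝ)
    (hxy : |x| ≤ |y|) : h₂ (τ x) (σ x) ≤ h₂ (τ y) (σ y) := by
  rw [p.rhs'_abs H x, p.rhs'_abs H y]
  exact H.mono₂ _ _ _ _ (p.nonneg (abs_nonneg x)) (p.mono hxy) (p.le_one _) (p.nonneg' _)
    (p.even_mono _ _ hxy) (p.le_one' _)

theorem rhs'_mem (p : IsProfile τ σ) (H : IsCooperativePair h₁ h₂) (x : ℝ) :
    0 ≤ h₂ (τ x) (σ x) ∧ h₂ (τ x) (σ x) ≤ 1 := by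
  rw [p.rhs'_abs H x]
  refine ⟨H.nonneg₂.trans (H.mono₂ _ _ _ _ le_rfl (p.nonneg (abs_nonneg x)) (p.le_one _) le_rfl
    (p.nonneg' _) (p.le_one' _)), ?_⟩
  conv_rhs => rw [← H.fix₂]
  exact H.mono₂ _ _ _ _ (p.nonneg (abs_nonneg x)) (p.le_one _) le_rfl (p.nonneg' _)
    (p.le_one' _) le_rfl

theorem abs_rhs'_le (p : IsProfile τ σ) (H : IsCooperativePair h₁ h₂) (x : ℝ) :
    |h₂ (τ x) (σ x)| ≤ 1 := by
  rw [abs_of_nonneg (p.rhs'_mem H x).1]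
  exact (p.rhs'_mem H x).2

theorem measurable_rhs (p : IsProfile τ σ) (H : IsCooperativePair h₁ h₂) :
    Measurable fun x => h₁ (τ x) (σ x) :=
  H.cont₁.measurable.comp (p.mono.measurable.prodMk p.meas)

theorem measurable_rhs' (p : IsProfile τ σ) (H : IsCooperativePair h₁ h₂) :
    Measurable fun x => h₂ (τ x) (σ x) :=
  H.cont₂.measurable.comp (p.mono.measurable.prodMk p.meas)

theorem step (p : IsProfile τ σ) (H : IsCooperativePair h₁ h₂) (hκ : 0 < κ) :
    IsProfile (greenOp κ fun x => h₁ (τ x) (σ x)) (greenOp κ fun x => h₂ (τ x) (σ x)) where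
  odd x := by
    rw [← greenOp_neg]
    simp only [p.rhs_odd H]
    have := greenOp_const_mul κ (-1) (fun x => h₁ (τ x) (σ x)) x
    simpa using this
  mono := greenOp_monotone hκ (p.abs_rhs_le H) (p.rhs_mono H)
  le_one := greenOp_le hκ (p.measurable_rhs H) (p.abs_rhs_le H) (p.rhs_le_one H)
  meas := (continuous_greenOp hκ (p.measurable_rhs' H) (p.abs_rhs'_le H)).measurable
  even_mono := greenOp_monotoneOn_of_even hκ (p.measurable_rhs' H) (p.abs_rhs'_le H)
    (p.rhs'_even_mono H)
  nonneg' := le_greenOp hκ (p.measurable_rhs' H) (p.abs_rhs'_le H) fun x => (p.rhs'_mem H x).1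
  le_one' := greenOp_le hκ (p.measurable_rhs' H) (p.abs_rhs'_le H) fun x => (p.rhs'_mem H x).2

theorem step_le_step (p : IsProfile τ σ) (p' : IsProfile τ' σ') (H : IsCooperativePair h₁ h₂)
    (hκ : 0 < κ) (hτ : ∀ x, 0 ≤ x → τ x ≤ τ' x) (hσ : ∀ x, σ x ≤ σ' x) :
    (∀ x, 0 ≤ x → greenOp κ (fun x => h₁ (τ x) (σ x)) x ≤
      greenOp κ (fun x => h₁ (τ' x) (σ' x)) x) ∧
    ∀ x, greenOp κ (fun x => h₂ (τ x) (σ x)) x ≤ greenOp κ (fun x => h₂ (τ' x) (σ' x)) x := by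
  constructor
  · intro x hx
    exact greenOp_mono_of_odd hκ (p.measurable_rhs H) (p.abs_rhs_le H) (p'.measurable_rhs H)
      (p'.abs_rhs_le H) (p.rhs_odd H) (p'.rhs_odd H)
      (fun y hy => H.mono₁ _ _ _ _ (p.nonneg hy) (hτ y hy) (p'.le_one y) (p.nonneg' y) (hσ y)
        (p'.le_one' y)) hx
  · refine greenOp_mono hκ (p.measurable_rhs' H) (p.abs_rhs'_le H) (p'.measurable_rhs' H)
      (p'.abs_rhs'_le H) fun y => ?_
    rw [p.rhs'_abs H y, p'.rhs'_abs H y]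
    exact H.mono₂ _ _ _ _ (p.nonneg (abs_nonneg y)) (hτ _ (abs_nonneg y)) (p'.le_one _)
      (p.nonneg' y) (hσ y) (p'.le_one' y)

end IsProfile

/-- Monotone iteration started from `(sign, 1)`. -/
theorem IsCooperativePair.exists_fixed_profile {h₁ h₂ : ℝ → ℝ → ℝ} (H : IsCooperativePair h₁ h₂)
    {κ : ℝ} (hκ : 0 < κ) {D β₀ β₁ : ℝ} (hD : 0 ≤ D) (hDβ : D ≤ β₀ + β₁)
    (hconstr : ∀ t s, |t| ≤ 1 → 0 ≤ s → s ≤ 1 → D * |t| ≤ β₀ + β₁ * s →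
      D * h₁ t s ≤ β₀ + β₁ * h₂ t s)
    {φ : ℝ → ℝ} (hφ : IsProfile φ fun _ => 0)
    (hsub : ∀ x, 0 ≤ x → φ x ≤ greenOp κ (fun x => h₁ (φ x) 0) x) :
    ∃ τ σ : ℝ → ℝ, IsProfile τ σ ∧ (∀ x, D * |τ x| ≤ β₀ + β₁ * σ x) ∧ (∀ x, 0 ≤ x → φ x ≤ τ x) ∧
      τ = greenOp κ (fun x => h₁ (τ x) (σ x)) ∧ σ = greenOp κ fun x => h₂ (τ x) (σ x) := by
  let F : (ℝ → ℝ) × (ℝ → ℝ) → (ℝ → ℝ) × (ℝ → ℝ) := fun q =>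
    (greenOp κ fun x => h₁ (q.1 x) (q.2 x), greenOp κ fun x => h₂ (q.1 x) (q.2 x))
  let S : ℕ → (ℝ → ℝ) × (ℝ → ℝ) := fun n => F^[n] (Real.sign, fun _ => 1)
  have hS : ∀ n, S (n + 1) = F (S n) := fun n => Function.iterate_succ_apply' F n _
  have hp : ∀ n, IsProfile (S n).1 (S n).2 := fun n => by
    induction n with
    | zero => exact IsProfile.sign
    | succ n ih => rw [hS]; exact ih.step H hκ
  have hdec : ∀ n, (∀ x, 0 ≤ x → (S (n + 1)).1 x ≤ (S n).1 x) ∧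
      ∀ x, (S (n + 1)).2 x ≤ (S n).2 x := fun n => by
    induction n with
    | zero =>
      refine ⟨fun x hx => ?_, (hp 1).le_one'⟩
      rcases hx.eq_or_lt with rfl | hx
      · rw [(hp 1).map_zero, (hp 0).map_zero]
      · rw [show (S 0).1 x = 1 from Real.sign_of_pos hx]
        exact (hp 1).le_one x
    | succ n ih =>
      have := (hp (n + 1)).step_le_step (hp n) H hκ ih.1 ih.2
      rw [hS (n + 1), hS n] at *
      exact this
  have hlow : ∀ n, ∀ x, 0 ≤ x → φ x ≤ (S n).1 x := fun n => by
    induction n with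
    | zero =>
      intro x hx
      rcases hx.eq_or_lt with rfl | hx
      · rw [hφ.map_zero, (hp 0).map_zero]
      · rw [show (S 0).1 x = 1 from Real.sign_of_pos hx]
        exact hφ.le_one x
    | succ n ih =>
      intro x hx
      have := (hφ.step_le_step (hp n) H hκ ih (hp n).nonneg').1 x hx
      rw [hS]
      exact (hsub x hx).trans this
  have hcon : ∀ n x, D * |(S n).1 x| ≤ β₀ + β₁ * (S n).2 x := fun n => by
    induction n with
    | zero =>
      intro x
      have : |(S 0).1 x| ≤ 1 := by rw [(hp 0).abs_eq]; exact (hp 0).le_one _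
      have h1 := mul_le_mul_of_nonneg_left this hD
      have h2 : (S 0).2 x = 1 := rfl
      rw [h2]
      linarith
    | succ n ih =>
      -- The constraint is affine and the Green kernel is positive of mass one, so the pointwise
      -- constraint on the right-hand sides passes to the iterate. The absolute value is recovered
      -- from parity.
      have h1 : ∀ x, D * (S (n + 1)).1 x ≤ β₀ + β₁ * (S (n + 1)).2 x := fun x => by
        rw [hS]
        simp only [F]
        rw [← greenOp_const_mul, ← greenOp_const_mul, ← greenOp_const hκ β₀ x]
        have m1 := (hp n).measurable_rhs H
        have m2 := (hp n).measurable_rhs' H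
        have b1 : ∀ y, |D * h₁ ((S n).1 y) ((S n).2 y)| ≤ D := fun y => by
          rw [abs_mul, abs_of_nonneg hD]
          exact mul_le_of_le_one_right hD ((hp n).abs_rhs_le H y)
        have b2 : ∀ y, |β₁ * h₂ ((S n).1 y) ((S n).2 y)| ≤ |β₁| := fun y => by
          rw [abs_mul]
          exact mul_le_of_le_one_right (abs_nonneg _) ((hp n).abs_rhs'_le H y)
        rw [← greenOp_add hκ measurable_const (fun _ => le_refl |β₀|) (m2.const_mul _) b2]
        refine greenOp_mono hκ (M := max D (|β₀| + |β₁|)) (m1.const_mul _)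
          (fun y => (b1 y).trans (le_max_left _ _)) (measurable_const.add (m2.const_mul _))
          (fun y => ((abs_add_le _ _).trans (add_le_add le_rfl (b2 y))).trans (le_max_right _ _))
          (fun y => ?_) x
        refine hconstr _ _ ?_ ((hp n).nonneg' y) ((hp n).le_one' y) (ih y)
        rw [(hp n).abs_eq]
        exact (hp n).le_one _
      intro x
      rcases abs_choice ((S (n + 1)).1 x) with h | h <;> rw [h]
      · exact h1 x
      · rw [← (hp (n + 1)).odd, ← (hp (n + 1)).even]
        exact h1 (-x)
  have hlim1' : ∀ x, 0 ≤ x → ∃ l, Tendsto (fun n => (S n).1 x) atTop (𝓝 l) := fun x hx =>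
    ⟨_, tendsto_atTop_ciInf (antitone_nat_of_succ_le fun n => (hdec n).1 x hx)
      ⟨0, by rintro _ ⟨n, rfl⟩; exact (hp n).nonneg hx⟩⟩
  have hlim1 : ∀ x, ∃ l, Tendsto (fun n => (S n).1 x) atTop (𝓝 l) := fun x => by
    rcases le_total 0 x with hx | hx
    · exact hlim1' x hx
    · obtain ⟨l, hl⟩ := hlim1' (-x) (by linarith)
      refine ⟨-l, hl.neg.congr fun n => ?_⟩
      rw [(hp n).odd, neg_neg]
  have hlim2 : ∀ x, ∃ l, Tendsto (fun n => (S n).2 x) atTop (𝓝 l) := fun x =>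
    ⟨_, tendsto_atTop_ciInf (antitone_nat_of_succ_le fun n => (hdec n).2 x)
      ⟨0, by rintro _ ⟨n, rfl⟩; exact (hp n).nonneg' x⟩⟩
  choose τ hτ using hlim1
  choose σ hσ using hlim2
  have e1 : ∀ x, Tendsto (fun n => (S (n + 1)).1 x) atTop (𝓝 (τ x)) := fun x =>
    (hτ x).comp (tendsto_add_atTop_nat 1)
  have e2 : ∀ x, Tendsto (fun n => (S (n + 1)).2 x) atTop (𝓝 (σ x)) := fun x =>
    (hσ x).comp (tendsto_add_atTop_nat 1)
  refine ⟨τ, σ, ⟨fun x => ?_, fun x y hxy => ?_, fun x => ?_, ?_, fun x y hxy => ?_, fun x => ?_,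
    fun x => ?_⟩, fun x => ?_, fun x hx => ?_, funext fun x => ?_, funext fun x => ?_⟩
  · exact tendsto_nhds_unique (hτ (-x)) ((hτ x).neg.congr fun n => ((hp n).odd x).symm)
  · exact le_of_tendsto_of_tendsto' (hτ x) (hτ y) fun n => (hp n).mono hxy
  · exact le_of_tendsto' (hτ x) fun n => (hp n).le_one x
  · exact measurable_of_tendsto_metrizable (fun n => (hp n).meas) (tendsto_pi_nhds.2 hσ)
  · exact le_of_tendsto_of_tendsto' (hσ x) (hσ y) fun n => (hp n).even_mono x y hxy
  · exact ge_of_tendsto' (hσ x) fun n => (hp n).nonneg' x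
  · exact le_of_tendsto' (hσ x) fun n => (hp n).le_one' x
  · exact le_of_tendsto_of_tendsto' ((hτ x).abs.const_mul D)
      (((hσ x).const_mul β₁).const_add β₀) fun n => hcon n x
  · exact ge_of_tendsto' (hτ x) fun n => hlow n x hx
  · refine tendsto_nhds_unique (e1 x) ?_
    simp only [hS]
    exact tendsto_greenOp_of_tendsto hκ (fun n => (hp n).measurable_rhs H)
      (fun n => (hp n).abs_rhs_le H)
      (fun y => (H.cont₁.tendsto (τ y, σ y)).comp ((hτ y).prodMk_nhds (hσ y))) x
  · refine tendsto_nhds_unique (e2 x) ?_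
    simp only [hS]
    exact tendsto_greenOp_of_tendsto hκ (fun n => (hp n).measurable_rhs' H)
      (fun n => (hp n).abs_rhs'_le H)
      (fun y => (H.cont₂.tendsto (τ y, σ y)).comp ((hτ y).prodMk_nhds (hσ y))) x

/-! ### Existence of a symmetric front -/

/-- Coefficients of the system satisfied by `s = u + v` and `d = v - u`, and the values of
`s`, `d` at the wells (`S`, `D`) and at the symmetric saddle (`c`, `0`). -/
structure IsFrontData (α ω A B c S D η : ℝ) : Prop where
  omega_pos : 0 < ω
  omega_lt : ω < α / 2
  A_eq : A = 1 / 2 + α / 4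
  B_eq : B = 1 / 2 - α / 4
  c_pos : 0 < c
  c_sq : A * c ^ 2 = 1 + ω
  D_pos : 0 < D
  D_lt : D < S
  well₁ : A * S ^ 2 + B * D ^ 2 = 1 + ω
  well₂ : A * D ^ 2 + B * S ^ 2 = 1 - ω
  eta_pos : 0 < η
  eta_eq : A * η * (S + c) = D ^ 2
  sub_eq : S - c = -(B * η)

theorem IsWellPair.exists_isFrontData {α ω a b : ℝ} (hw : IsWellPair α ω a b) :
    ∃ A B c η, IsFrontData α ω A B c (a + b) (b - a) η := by
  have hα := hw.alpha_pos
  have hω := hw.omega_pos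
  have ha := hw.pos
  have hab := hw.lt
  have hA : 0 < 1 / 2 + α / 4 := by linarith
  have hc : 0 < Real.sqrt ((1 + ω) / (1 / 2 + α / 4)) := Real.sqrt_pos.2 (by positivity)
  have hc2 : (1 / 2 + α / 4) * Real.sqrt ((1 + ω) / (1 / 2 + α / 4)) ^ 2 = 1 + ω := by
    rw [Real.sq_sqrt (by positivity)]; field_simp
  set c := Real.sqrt ((1 + ω) / (1 / 2 + α / 4))
  set A := 1 / 2 + α / 4 with hAdef
  have hSc : 0 < a + b + c := by linarith
  have w1 : A * (a + b) ^ 2 + (1 / 2 - α / 4) * (b - a) ^ 2 = 1 + ω := by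
    rw [hAdef]; linear_combination hw.sq_add_sq + hw.mul_eq
  have hη : A * ((b - a) ^ 2 / (A * (a + b + c))) * (a + b + c) = (b - a) ^ 2 := by
    field_simp
  refine ⟨A, 1 / 2 - α / 4, c, (b - a) ^ 2 / (A * (a + b + c)), hω, hw.omega_lt, rfl, rfl, hc, hc2,
    by linarith, by linarith, w1, ?_, ?_, hη, ?_⟩
  · rw [hAdef]; linear_combination hw.sq_add_sq - hw.mul_eq
  · have := sub_pos.2 hab
    positivity
  · have h0 : A * (a + b + c) ≠ 0 := by positivity
    apply mul_left_cancel₀ h0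
    linear_combination w1 - hc2 + (1 / 2 - α / 4) * hη

/-- The interpolation of `s` between the saddle and the wells. -/
def frontSum (c S σ : ℝ) : ℝ := c + (S - c) * σ

/-- The nonlinearity for the normalised difference `τ = d / D`. -/
def frontDiffRhs (ω A B c S D τ σ : ℝ) : ℝ :=
  τ * (A * D ^ 2 * τ ^ 2 + B * frontSum c S σ ^ 2 - 1 + ω)

/-- The nonlinearity for the interpolation parameter `σ`. -/
def frontSumRhs (A c S τ σ : ℝ) : ℝ :=
  A * frontSum c S σ * (σ * (frontSum c S σ + c) - (S + c) * τ ^ 2)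

namespace IsFrontData

variable {α ω A B c S D η : ℝ}

theorem A_pos (h : IsFrontData α ω A B c S D η) : 0 < A := by
  rw [h.A_eq]; linarith [h.omega_pos, h.omega_lt]

theorem S_pos (h : IsFrontData α ω A B c S D η) : 0 < S := h.D_pos.trans h.D_lt

theorem frontSum_pos (h : IsFrontData α ω A B c S D η) {σ : ℝ} (h0 : 0 ≤ σ) (h1 : σ ≤ 1) :
    0 < frontSum c S σ := by
  have : frontSum c S σ = c * (1 - σ) + S * σ := by unfold frontSum; ring
  rw [this]
  rcases h0.eq_or_lt with rfl | h0
  · simpa using h.c_pos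
  · have := mul_pos h.S_pos h0
    have := mul_nonneg h.c_pos.le (sub_nonneg.2 h1)
    linarith

theorem frontSum_le (h : IsFrontData α ω A B c S D η) {σ : ℝ} (h0 : 0 ≤ σ) (h1 : σ ≤ 1) :
    frontSum c S σ ≤ c + S := by
  unfold frontSum
  nlinarith [h.c_pos, h.S_pos]

/-- `frontSumRhs` is the s-equation divided by S - c, in a form that still makes sense when α = 2,
where B = 0 and S = c. -/
theorem sum_eq (h : IsFrontData α ω A B c S D η) (τ σ : ℝ) :
    (S - c) * frontSumRhs A c S τ σ = frontSum c S σ *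
      (A * frontSum c S σ ^ 2 + B * (D * τ) ^ 2 - 1 - ω) := by
  have e : frontSum c S σ - c = (S - c) * σ := by unfold frontSum; ring
  unfold frontSumRhs
  set s := frontSum c S σ
  linear_combination (-(A * s * (s + c))) * e - (A * s * (S + c) * τ ^ 2) * h.sub_eq
    + s * B * τ ^ 2 * h.eta_eq - s * h.c_sq

/-- The coupling B s² has σ-derivative 2B s (S - c) = -2B² η s ≤ 0: the sign of B enters twice, so a
single cooperative formulation covers all α. -/
theorem frontDiffRhs_anti (h : IsFrontData α ω A B c S D η) {τ σ σ' : ℝ} (hτ : 0 ≤ τ)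
    (h0 : 0 ≤ σ) (h1 : σ ≤ σ') (h2 : σ' ≤ 1) :
    frontDiffRhs ω A B c S D τ σ' ≤ frontDiffRhs ω A B c S D τ σ := by
  have s1 := h.frontSum_pos h0 (h1.trans h2)
  have s2 := h.frontSum_pos (h0.trans h1) h2
  have e : frontSum c S σ' - frontSum c S σ = -(B * η) * (σ' - σ) := by
    rw [← h.sub_eq]; unfold frontSum; ring
  have : frontDiffRhs ω A B c S D τ σ - frontDiffRhs ω A B c S D τ σ' =
      τ * (B ^ 2 * η * (σ' - σ) * (frontSum c S σ + frontSum c S σ')) := by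
    unfold frontDiffRhs
    linear_combination (-(τ * B * (frontSum c S σ + frontSum c S σ'))) * e
  rw [← sub_nonneg, this]
  have := h.eta_pos
  have := sub_nonneg.2 h1
  positivity

theorem frontSumRhs_anti (h : IsFrontData α ω A B c S D η) {τ τ' σ : ℝ} (hτ : 0 ≤ τ)
    (hττ' : τ ≤ τ') (h0 : 0 ≤ σ) (h1 : σ ≤ 1) :
    frontSumRhs A c S τ' σ ≤ frontSumRhs A c S τ σ := by
  have s1 := h.frontSum_pos h0 h1
  have : frontSumRhs A c S τ σ - frontSumRhs A c S τ' σ =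
      A * frontSum c S σ * (S + c) * (τ' ^ 2 - τ ^ 2) := by unfold frontSumRhs; ring
  rw [← sub_nonneg, this]
  have h2 : 0 ≤ τ' ^ 2 - τ ^ 2 := by nlinarith
  have := h.A_pos
  have := h.S_pos
  have := h.c_pos
  positivity

theorem exists_lipschitz {f : ℝ → ℝ → ℝ} (hf : ContDiff ℝ 1 fun p : ℝ × ℝ => f p.1 p.2) :
    ∃ K : ℝ, ∀ t ∈ Set.Icc (0 : ℝ) 1, ∀ s ∈ Set.Icc (0 : ℝ) 1, ∀ t' ∈ Set.Icc (0 : ℝ) 1,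
      ∀ s' ∈ Set.Icc (0 : ℝ) 1, |f t s - f t' s'| ≤ K * max |t - t'| |s - s'| := by
  obtain ⟨K, hK⟩ := (hf.locallyLipschitz.locallyLipschitzOn
    (s := Set.Icc (0 : ℝ) 1 ×ˢ Set.Icc (0 : ℝ) 1)).exists_lipschitzOnWith_of_compact
      (isCompact_Icc.prod isCompact_Icc)
  refine ⟨K, fun t ht s hs t' ht' s' hs' => ?_⟩
  have := hK.dist_le_mul (t, s) ⟨ht, hs⟩ (t', s') ⟨ht', hs'⟩
  rwa [Real.dist_eq, Prod.dist_eq, Real.dist_eq, Real.dist_eq] at this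

theorem isCooperativePair (h : IsFrontData α ω A B c S D η) {κ K₁ K₂ : ℝ} (hκ : 0 < κ)
    (hK₁ : ∀ t ∈ Set.Icc (0 : ℝ) 1, ∀ s ∈ Set.Icc (0 : ℝ) 1, ∀ t' ∈ Set.Icc (0 : ℝ) 1,
      ∀ s' ∈ Set.Icc (0 : ℝ) 1, |frontDiffRhs ω A B c S D t s - frontDiffRhs ω A B c S D t' s'| ≤
        K₁ * max |t - t'| |s - s'|)
    (hK₂ : ∀ t ∈ Set.Icc (0 : ℝ) 1, ∀ s ∈ Set.Icc (0 : ℝ) 1, ∀ t' ∈ Set.Icc (0 : ℝ) 1,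
      ∀ s' ∈ Set.Icc (0 : ℝ) 1, |frontSumRhs A c S t s - frontSumRhs A c S t' s'| ≤
        K₂ * max |t - t'| |s - s'|)
    (h1 : K₁ ≤ κ ^ 2) (h2 : K₂ ≤ κ ^ 2) :
    IsCooperativePair (fun t s => t - frontDiffRhs ω A B c S D t s / κ ^ 2)
      (fun t s => s - frontSumRhs A c S t s / κ ^ 2) where
  cont₁ := by unfold frontDiffRhs frontSum; fun_prop
  cont₂ := by unfold frontSumRhs frontSum; fun_prop
  odd t s := by unfold frontDiffRhs; ring
  even t s := by unfold frontSumRhs; ring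
  mono₁ t t' s s' ht htt' ht' hs hss' hs' := by
    have b1 := (abs_le.1 (hK₁ t' ⟨ht.trans htt', ht'⟩ s ⟨hs, hss'.trans hs'⟩ t ⟨ht, htt'.trans ht'⟩
      s ⟨hs, hss'.trans hs'⟩)).2
    rw [sub_self s, abs_zero, max_eq_left (abs_nonneg _), abs_of_nonneg (sub_nonneg.2 htt')] at b1
    have b2 := h.frontDiffRhs_anti (τ := t') (ht.trans htt') hs hss' hs'
    have b3 := mul_le_mul_of_nonneg_right h1 (sub_nonneg.2 htt')
    have b4 : frontDiffRhs ω A B c S D t' s' - frontDiffRhs ω A B c S D t s ≤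
        κ ^ 2 * (t' - t) := by linarith
    rw [← div_le_iff₀' (by positivity), sub_div] at b4
    linarith
  mono₂ t t' s s' ht htt' ht' hs hss' hs' := by
    have b1 := (abs_le.1 (hK₂ t ⟨ht, htt'.trans ht'⟩ s' ⟨hs.trans hss', hs'⟩ t ⟨ht, htt'.trans ht'⟩
      s ⟨hs, hss'.trans hs'⟩)).2
    rw [sub_self t, abs_zero, max_eq_right (abs_nonneg _), abs_of_nonneg (sub_nonneg.2 hss')] at b1
    have b2 := h.frontSumRhs_anti ht htt' (hs.trans hss') hs'
    have b3 := mul_le_mul_of_nonneg_right h2 (sub_nonneg.2 hss')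
    have b4 : frontSumRhs A c S t' s' - frontSumRhs A c S t s ≤ κ ^ 2 * (s' - s) := by linarith
    rw [← div_le_iff₀' (by positivity), sub_div] at b4
    linarith
  fix₁ := by
    have : frontDiffRhs ω A B c S D 1 1 = 0 := by
      unfold frontDiffRhs frontSum; linear_combination h.well₂
    rw [this]; simp
  fix₂ := by
    have : frontSumRhs A c S 1 1 = 0 := by unfold frontSumRhs frontSum; ring
    rw [this]; simp
  nonneg₂ := by simp [frontSumRhs]

/-- The constraint says s ≥ |d|, that is, both components are nonnegative. The difference of the s-
and d-equations is (s - d) times a factor bounded by κ², minus ω (s + d), and the last term has the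
favourable sign. -/
theorem constraint (h : IsFrontData α ω A B c S D η) {κ : ℝ} (hκ : 0 < κ)
    (hκ2 : (1 + α) * (c + S) ^ 2 ≤ κ ^ 2) {t s : ℝ} (h0 : 0 ≤ s) (h1 : s ≤ 1)
    (hc : D * |t| ≤ c + (S - c) * s) :
    D * (t - frontDiffRhs ω A B c S D t s / κ ^ 2) ≤
      c + (S - c) * (s - frontSumRhs A c S t s / κ ^ 2) := by
  have e1 : D * frontDiffRhs ω A B c S D t s = D * t *
      (A * (D * t) ^ 2 + B * frontSum c S s ^ 2 - 1 + ω) := by unfold frontDiffRhs; ring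
  have e2 := h.sum_eq t s
  have p0 := h.frontSum_pos h0 h1
  have p1 := h.frontSum_le h0 h1
  have hα : 0 < α := by linarith [h.omega_pos, h.omega_lt]
  have hd1 : D * t ≤ frontSum c S s := (mul_le_mul_of_nonneg_left (le_abs_self t) h.D_pos.le).trans hc
  have hd2 : -(D * t) ≤ frontSum c S s := by
    rw [← mul_neg]
    exact (mul_le_mul_of_nonneg_left (neg_le_abs t) h.D_pos.le).trans hc
  have hs : frontSum c S s = c + (S - c) * s := rfl
  set σ := frontSum c S s
  set d := D * t
  have key : (S - c) * frontSumRhs A c S t s - D * frontDiffRhs ω A B c S D t s ≤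
      κ ^ 2 * (σ - d) := by
    rw [e1, e2, h.A_eq, h.B_eq]
    have e3 : σ * ((1 / 2 + α / 4) * σ ^ 2 + (1 / 2 - α / 4) * d ^ 2 - 1 - ω) -
        d * ((1 / 2 + α / 4) * d ^ 2 + (1 / 2 - α / 4) * σ ^ 2 - 1 + ω) =
        (σ - d) * ((σ ^ 2 + d ^ 2) / 2 - 1 + α * ((σ + d) / 2) ^ 2) - ω * (σ + d) := by ring
    rw [e3]
    have h3 : (σ ^ 2 + d ^ 2) / 2 - 1 + α * ((σ + d) / 2) ^ 2 ≤ κ ^ 2 := by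
      have q1 : d ^ 2 ≤ σ ^ 2 := by nlinarith
      have q2 : ((σ + d) / 2) ^ 2 ≤ σ ^ 2 := by nlinarith
      have q3 : σ ^ 2 ≤ (c + S) ^ 2 := by gcongr
      nlinarith [mul_le_mul_of_nonneg_left (q2.trans q3) hα.le]
    have h4 := mul_le_mul_of_nonneg_left h3 (sub_nonneg.2 hd1)
    have h5 : 0 ≤ ω * (σ + d) := mul_nonneg h.omega_pos.le (by linarith)
    linarith
  rw [← div_le_iff₀' (by positivity), sub_div, mul_div_assoc, mul_div_assoc] at key
  rw [mul_sub, mul_sub]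
  linarith

end IsFrontData

/-! ### The tanh subsolution and the limiting states -/

theorem hasDerivAt_tanh_mul (k x : ℝ) : HasDerivAt (fun x => Real.tanh (k * x))
    (k * (1 - Real.tanh (k * x) ^ 2)) x := by
  have hlin : HasDerivAt (fun x : ℝ => k * x) k x := by
    simpa using (hasDerivAt_id x).const_mul k
  have h := hlin.sinh.div hlin.cosh (Real.cosh_pos (k * x)).ne'
  have e : (fun x => Real.tanh (k * x)) = fun x => Real.sinh (k * x) / Real.cosh (k * x) :=
    funext fun x => Real.tanh_eq_sinh_div_cosh _
  rw [e]
  refine h.congr_deriv ?_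
  have hc := (Real.cosh_pos (k * x)).ne'
  rw [Real.tanh_eq_sinh_div_cosh]
  field_simp

theorem deriv_deriv_affine {f g : ℝ → ℝ} (hf : ContDiff ℝ 2 f) (hg : ContDiff ℝ 2 g)
    (p q r x : ℝ) : deriv (deriv fun y => p + q * f y + r * g y) x =
      q * deriv (deriv f) x + r * deriv (deriv g) x := by
  have h1 : (deriv fun y => p + q * f y + r * g y) = fun y => q * deriv f y + r * deriv g y :=
    funext fun y => ((((hf.hasDerivAt_two y).1.const_mul q).const_add p).add
      ((hg.hasDerivAt_two y).1.const_mul r)).deriv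
  rw [h1]
  exact (((hf.hasDerivAt_two x).2.const_mul q).add ((hg.hasDerivAt_two x).2.const_mul r)).deriv

namespace IsFrontData

variable {α ω A B c S D η : ℝ}

/-- A hyperbolic tangent profile is an exact solution for the first equation at the saddle value
of the sum. -/
theorem exists_subprofile (h : IsFrontData α ω A B c S D η) : ∃ φ : ℝ → ℝ,
    IsProfile φ (fun _ => 0) ∧ 0 < φ 1 ∧ ContDiff ℝ 2 φ ∧
      ∀ x, deriv (deriv φ) x = frontDiffRhs ω A B c S D (φ x) 0 := by
  have hA := h.A_pos
  have hD := h.D_pos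
  -- At s = c the equation is τ'' = τ (A D² τ² - l). Positivity of l is exactly ω < α/2, and θ
  -- tanh(kx) solves it when k² = l/2 and A D² θ² = l.
  have hl : 0 < 1 - ω - B * c ^ 2 := by
    have : A * (1 - ω - B * c ^ 2) = α / 2 - ω := by
      rw [mul_sub, mul_left_comm, h.c_sq, h.A_eq, h.B_eq]; ring
    have h2 := sub_pos.2 h.omega_lt
    rw [← this] at h2
    exact pos_of_mul_pos_right h2 hA.le
  set l := 1 - ω - B * c ^ 2 with hldef
  set k := Real.sqrt (l / 2) with hk
  set θ := Real.sqrt (l / (A * D ^ 2)) with hθ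
  have hk0 : 0 < k := Real.sqrt_pos.2 (by positivity)
  have hθ0 : 0 < θ := Real.sqrt_pos.2 (by positivity)
  have hk2 : k ^ 2 = l / 2 := Real.sq_sqrt (by positivity)
  have hθ2 : A * D ^ 2 * θ ^ 2 = l := by rw [hθ, Real.sq_sqrt (by positivity)]; field_simp
  have hθ1 : θ ≤ 1 := by
    have hle : l ≤ A * D ^ 2 := by
      have : A * D ^ 2 - l = B ^ 2 * η * (S + c) := by
        linear_combination h.well₂ - hldef - B * (S + c) * h.sub_eq
      have h2 : 0 ≤ B ^ 2 * η * (S + c) := by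
        have := h.eta_pos
        have := h.S_pos
        have := h.c_pos
        positivity
      linarith
    rw [hθ, Real.sqrt_le_iff]
    exact ⟨zero_le_one, by rw [one_pow]; exact div_le_one_of_le₀ hle (by positivity)⟩
  let T : ℝ → ℝ := fun x => Real.tanh (k * x)
  have hT : ∀ x, HasDerivAt T (k * (1 - T x ^ 2)) x := hasDerivAt_tanh_mul k
  have hT1 : ∀ x, -1 < T x ∧ T x < 1 := fun x => ⟨Real.neg_one_lt_tanh _, Real.tanh_lt_one _⟩
  have hTm : StrictMono T := strictMono_of_hasDerivAt_pos hT fun x =>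
    mul_pos hk0 (by nlinarith [hT1 x])
  have hTc : Continuous T := continuous_iff_continuousAt.2 fun x => (hT x).continuousAt
  have hd1 : ∀ x, HasDerivAt (fun x => θ * T x) (θ * (k * (1 - T x ^ 2))) x := fun x =>
    (hT x).const_mul θ
  have hd2 : ∀ x, HasDerivAt (fun x => θ * (k * (1 - T x ^ 2)))
      (θ * (k * (-(2 * T x * (k * (1 - T x ^ 2)))))) x := fun x => by
    refine (((((hT x).pow 2).const_sub 1).const_mul k).const_mul θ).congr_deriv ?_
    push_cast
    ring
  obtain ⟨r1, r2⟩ := contDiff_two_of_hasDerivAt hd1 hd2 (by fun_prop)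
  refine ⟨fun x => θ * T x, ⟨fun x => ?_, hTm.monotone.const_mul hθ0.le, fun x => ?_,
    measurable_const, fun _ _ _ => le_rfl, fun _ => le_rfl, fun _ => zero_le_one⟩, ?_, r1,
    fun x => ?_⟩
  · simp [T]
  · nlinarith [hT1 x]
  · have h0 : T 0 = 0 := by simp [T]
    have := hTm (zero_lt_one' ℝ)
    rw [h0] at this
    exact mul_pos hθ0 this
  · rw [r2]
    simp only [frontDiffRhs, frontSum]
    linear_combination (-(2 * θ * T x * (1 - T x ^ 2))) * hk2 - θ * T x ^ 3 * hθ2 - θ * T x * hldef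

/-- A monotone front of the normalised system. -/
theorem exists_front (h : IsFrontData α ω A B c S D η) : ∃ τ σ : ℝ → ℝ,
    IsProfile τ σ ∧ (∀ x, D * |τ x| ≤ frontSum c S (σ x)) ∧
      ContDiff ℝ 2 τ ∧ ContDiff ℝ 2 σ ∧
      (∀ x, deriv (deriv τ) x = frontDiffRhs ω A B c S D (τ x) (σ x)) ∧
      (∀ x, deriv (deriv σ) x = frontSumRhs A c S (τ x) (σ x)) ∧
      ∃ t s, Tendsto τ atTop (𝓝 t) ∧ Tendsto σ atTop (𝓝 s) ∧ 0 < t ∧ 0 ≤ s ∧ s ≤ 1 ∧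
        frontDiffRhs ω A B c S D t s = 0 ∧ frontSumRhs A c S t s = 0 := by
  obtain ⟨K₁, hK₁⟩ := exists_lipschitz (f := frontDiffRhs ω A B c S D)
    (by unfold frontDiffRhs frontSum; fun_prop)
  obtain ⟨K₂, hK₂⟩ := exists_lipschitz (f := frontSumRhs A c S)
    (by unfold frontSumRhs frontSum; fun_prop)
  obtain ⟨κ, hκ, hκK⟩ : ∃ κ : ℝ, 0 < κ ∧
      max (max K₁ K₂) ((1 + α) * (c + S) ^ 2) ≤ κ ^ 2 := by
    set M := max (max K₁ K₂) ((1 + α) * (c + S) ^ 2)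
    refine ⟨1 + |M|, by positivity, ?_⟩
    nlinarith [le_abs_self M, abs_nonneg M]
  have k1 := ((le_max_left K₁ K₂).trans (le_max_left _ _)).trans hκK
  have k2 := ((le_max_right K₁ K₂).trans (le_max_left _ _)).trans hκK
  have k3 := (le_max_right (max K₁ K₂) _).trans hκK
  have H := h.isCooperativePair hκ hK₁ hK₂ k1 k2
  have hκ2 : κ ^ 2 ≠ 0 := by positivity
  obtain ⟨φ, hφ, hφ1, hφc, hφd⟩ := h.exists_subprofile
  -- φ solves the first equation exactly with σ = 0, so the maximum principle places it below its
  -- own image under the iteration.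
  obtain ⟨τ, σ, p, hcon, hlow, e1, e2⟩ := H.exists_fixed_profile hκ (D := D) (β₀ := c)
    (β₁ := S - c) h.D_pos.le (by linarith [h.D_lt])
    (fun t s _ h0 h1 hc => h.constraint hκ k3 h0 h1 hc) hφ (fun x _ =>
      le_greenOp_of_deriv_deriv_ge hκ
        (H.cont₁.comp (hφc.continuous.prodMk continuous_const)) (hφ.abs_rhs_le H) hφc hφ.le_one
        (fun x => by rw [hφd]; exact le_of_eq (by simp; field_simp)) x)
  have cτ : Continuous τ := by
    rw [e1]; exact continuous_greenOp hκ (p.measurable_rhs H) (p.abs_rhs_le H)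
  have cσ : Continuous σ := by
    rw [e2]; exact continuous_greenOp hκ (p.measurable_rhs' H) (p.abs_rhs'_le H)
  obtain ⟨r1, r1'⟩ := greenOp_contDiff hκ (H.cont₁.comp (cτ.prodMk cσ)) (p.abs_rhs_le H)
  obtain ⟨r2, r2'⟩ := greenOp_contDiff hκ (H.cont₂.comp (cτ.prodMk cσ)) (p.abs_rhs'_le H)
  simp only [Function.comp_def] at r1 r1' r2 r2'
  rw [← e1] at r1 r1'
  rw [← e2] at r2 r2'
  have hτlim : Tendsto τ atTop (𝓝 (⨆ x, τ x)) :=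
    tendsto_atTop_ciSup p.mono ⟨1, by rintro _ ⟨x, rfl⟩; exact p.le_one x⟩
  obtain ⟨s, hσlim⟩ : ∃ s, Tendsto σ atTop (𝓝 s) := by
    have hm : Monotone fun x => σ (max x 0) := fun x y hxy => p.even_mono _ _ (by
      rw [abs_of_nonneg (le_max_right _ _), abs_of_nonneg (le_max_right _ _)]
      exact max_le_max_right 0 hxy)
    refine ⟨_, (tendsto_atTop_ciSup hm ⟨1, by rintro _ ⟨x, rfl⟩; exact p.le_one' _⟩).congr' ?_⟩
    filter_upwards [eventually_ge_atTop 0] with x hx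
    rw [max_eq_left hx]
  have hpos : 0 < τ 1 := hφ1.trans_le (hlow 1 zero_le_one)
  refine ⟨τ, σ, p, hcon, r1, r2, fun x => ?_, fun x => ?_, _, s, hτlim, hσlim, ?_, ?_, ?_,
    ?_, ?_⟩
  · rw [r1']; field_simp; ring
  · rw [r2']; field_simp; ring
  · exact hpos.trans_le (le_ciSup (f := τ) ⟨1, by rintro _ ⟨x, rfl⟩; exact p.le_one x⟩ 1)
  · exact ge_of_tendsto' hσlim p.nonneg'
  · exact le_of_tendsto' hσlim p.le_one'
  · have := tendsto_greenOp_atTop hκ (p.measurable_rhs H) (p.abs_rhs_le H)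
      ((H.cont₁.tendsto (_, s)).comp (hτlim.prodMk_nhds hσlim))
    rw [← e1] at this
    have := tendsto_nhds_unique hτlim this
    simp only [] at this
    have h0 : frontDiffRhs ω A B c S D (⨆ x, τ x) s / κ ^ 2 = 0 := by linarith
    exact (div_eq_zero_iff.1 h0).resolve_right hκ2
  · have := tendsto_greenOp_atTop hκ (p.measurable_rhs' H) (p.abs_rhs'_le H)
      ((H.cont₂.tendsto (_, s)).comp (hτlim.prodMk_nhds hσlim))
    rw [← e2] at this
    have := tendsto_nhds_unique hσlim this
    simp only [] at this
    have h0 : frontSumRhs A c S (⨆ x, τ x) s / κ ^ 2 = 0 := by linarith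
    exact (div_eq_zero_iff.1 h0).resolve_right hκ2

/-- The only nontrivial limiting state in the cooperative range is the well. -/
theorem eq_well (h : IsFrontData α ω A B c S D η) {t s : ℝ} (ht : 0 < t) (h0 : 0 ≤ s)
    (h1 : s ≤ 1) (e1 : frontDiffRhs ω A B c S D t s = 0) (e2 : frontSumRhs A c S t s = 0) :
    t = 1 ∧ frontSum c S s = S := by
  have hs := h.frontSum_pos h0 h1
  have e3 := h.sum_eq t s
  rw [e2, mul_zero, eq_comm, mul_eq_zero, or_iff_right hs.ne'] at e3
  rw [frontDiffRhs, mul_eq_zero, or_iff_right ht.ne'] at e1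
  have hAB : A ^ 2 - B ^ 2 = α / 2 := by rw [h.A_eq, h.B_eq]; ring
  have hα : 0 < α / 2 := h.omega_pos.trans h.omega_lt
  set σ := frontSum c S s
  -- The two equilibrium equations are linear in (s², d²) with determinant A² - B² = α/2 up to sign,
  -- so the squares are those of the well.
  have hd : (A ^ 2 - B ^ 2) * (D ^ 2 * (t ^ 2 - 1)) = 0 := by
    linear_combination A * e1 - B * e3 - A * h.well₂ + B * h.well₁
  have hσ : (A ^ 2 - B ^ 2) * (σ ^ 2 - S ^ 2) = 0 := by
    linear_combination A * e3 - B * e1 - A * h.well₁ + B * h.well₂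
  rw [hAB] at hd hσ
  have hD : D ^ 2 ≠ 0 := pow_ne_zero 2 h.D_pos.ne'
  have t2 : t ^ 2 = 1 := by
    have := (mul_eq_zero.1 ((mul_eq_zero.1 hd).resolve_left hα.ne')).resolve_left hD
    linarith
  have s2 : σ ^ 2 = S ^ 2 := by
    have := (mul_eq_zero.1 hσ).resolve_left hα.ne'
    linarith
  refine ⟨?_, ?_⟩
  · nlinarith
  · exact (sq_eq_sq₀ hs.le h.S_pos.le).1 s2

end IsFrontData

/-! ### From the normalised front to the heteroclinic -/

theorem IsWellPair.exists_heteroclinic {α ω a b : ℝ} (hw : IsWellPair α ω a b) :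
    ∃ u v, IsPositiveHeteroclinic α ω a b u v := by
  obtain ⟨A, B, c, η, h⟩ := hw.exists_isFrontData
  obtain ⟨τ, σ, p, hcon, cτ, cσ, dτ, dσ, t, s, lτ, lσ, ht, h0, h1, e1, e2⟩ := h.exists_front
  obtain ⟨rfl, hs⟩ := h.eq_well ht h0 h1 e1 e2
  set S := a + b with hS
  set D := b - a with hD
  -- One family for both components: r = D/2 gives u and r = -D/2 gives v, so Dτ = u - v here. The
  -- d-equation is odd, so this sign is immaterial.
  let w : ℝ → ℝ → ℝ := fun r x => c / 2 + (S - c) / 2 * σ x + r * τ x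
  have hw_eq : ∀ r x, w r x = (frontSum c S (σ x)) / 2 + r * τ x := fun r x => by
    simp only [w, frontSum]; ring
  have cw : ∀ r, ContDiff ℝ 2 (w r) := fun r => by fun_prop
  have dw : ∀ r x, deriv (deriv (w r)) x =
      (S - c) / 2 * frontSumRhs A c S (τ x) (σ x) + r * frontDiffRhs ω A B c S D (τ x) (σ x) :=
    fun r x => by rw [deriv_deriv_affine cσ cτ, dσ, dτ]
  have eqw : ∀ r, r = D / 2 ∨ r = -(D / 2) → ∀ x,
      deriv (deriv (w r)) x = rhsF α ω (w r x) (w (-r) x) := by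
    intro r hr x
    have hr2 : r ^ 2 = D ^ 2 / 4 := by rcases hr with rfl | rfl <;> ring
    have e3 := h.sum_eq (τ x) (σ x)
    rw [dw, hw_eq, hw_eq]
    simp only [rhsF, frontDiffRhs]
    rw [h.A_eq, h.B_eq] at *
    set q := frontSum c S (σ x)
    linear_combination (1 / 2 : ℝ) * e3 - (r * τ x ^ 3 * (2 + α) + q * τ x ^ 2 * (1 - α / 2)) * hr2
  have nonneg : ∀ r, r = D / 2 ∨ r = -(D / 2) → ∀ x, 0 ≤ w r x := by
    intro r hr x
    have := hcon x
    have hD0 := h.D_pos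
    rw [hw_eq]
    have h2 := mul_le_mul_of_nonneg_left (le_abs_self (τ x)) hD0.le
    have h3 := mul_le_mul_of_nonneg_left (neg_le_abs (τ x)) hD0.le
    rcases hr with rfl | rfl <;> linarith
  have pos : ∀ r, r = D / 2 ∨ r = -(D / 2) → ∀ x, 0 < w r x := by
    intro r hr x
    -- A zero would be a minimum, but there the other component equals s > 0 and the second
    -- derivative is -ω s < 0.
    refine lt_of_le_of_ne (nonneg r hr x) fun hx => ?_
    have hmin : IsLocalMin (w r) x := Eventually.of_forall fun y => by
      rw [← hx]; exact nonneg r hr y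
    have h2 := deriv_deriv_nonneg_of_isLocalMin hmin (cw r).continuous.continuousAt
    have hsum : w r x + w (-r) x = frontSum c S (σ x) := by rw [hw_eq, hw_eq]; ring
    have hpos := h.frontSum_pos (p.nonneg' x) (p.le_one' x)
    rw [eqw r hr, rhsF, ← hx] at h2
    rw [← hx] at hsum
    have := hw.omega_pos
    nlinarith
  have refl : ∀ r x, w r (-x) = w (-r) x := fun r x => by
    simp only [w, p.even, p.odd]; ring
  have top : ∀ r, Tendsto (w r) atTop (𝓝 (S / 2 + r)) := fun r => by
    have := (((lσ.const_mul ((S - c) / 2)).const_add (c / 2)).add (lτ.const_mul r))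
    have e : c / 2 + (S - c) / 2 * s + r * 1 = S / 2 + r := by
      rw [frontSum] at hs; linarith
    rwa [e] at this
  have bot : ∀ r, Tendsto (w r) atBot (𝓝 (S / 2 - r)) := fun r => by
    have := (top (-r)).comp tendsto_neg_atBot_atTop
    refine this.congr fun x => ?_
    rw [Function.comp_apply, refl, neg_neg]
  refine ⟨w (D / 2), w (-(D / 2)), cw _, cw _, eqw _ (Or.inl rfl), fun x => ?_,
    pos _ (Or.inl rfl), pos _ (Or.inr rfl), ?_, ?_, ?_, ?_⟩
  · rw [rhsG_eq_rhsF, eqw _ (Or.inr rfl), neg_neg]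
  · convert bot (D / 2) using 2; rw [hS, hD]; ring
  · convert bot (-(D / 2)) using 2; rw [hS, hD]; ring
  · convert top (D / 2) using 2; rw [hS, hD]; ring
  · convert top (-(D / 2)) using 2; rw [hS, hD]; ring

theorem mainTheorem4 (α ω a b : ℝ) (hω : 0 < ω) (hωα : ω < α / 2)
    (hab_sq : a ^ 2 + b ^ 2 = 1) (hab_mul : a * b = ω / α) (ha : 0 < a) (hab : a < b) :
    (∃ u v : ℝ → ℝ, IsPositiveHeteroclinic α ω a b u v) ∧
    (∀ u v u' v' : ℝ → ℝ,
      IsPositiveHeteroclinic α ω a b u v → IsPositiveHeteroclinic α ω a b u' v' →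
        ∃ T : ℝ, ∀ x : ℝ, u' x = u (x + T) ∧ v' x = v (x + T)) ∧
    (∀ u v : ℝ → ℝ, IsPositiveHeteroclinic α ω a b u v →
      ∀ x : ℝ, 0 < deriv u x ∧ deriv v x < 0) := by
  have hα : α ≠ 0 := by linarith
  have hw : IsWellPair α ω a b :=
    ⟨hω, hωα, hab_sq, by rw [hab_mul]; field_simp, ha, hab⟩
  refine ⟨hw.exists_heteroclinic, fun u v u' v' h h' => ?_, fun u v h x =>
    ⟨h.deriv_u_pos hw x, h.deriv_v_neg hw x⟩⟩
  obtain ⟨T, hT, -⟩ := h.exists_eq_translate h' hw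
  exact ⟨T, hT⟩
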